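/- Let $\mathbb{K}$ be a field of characteristic $0$. A differential graded Lie algebra (DGLA) over $\mathbb{K}$ is a $\mathbb{Z}$-graded vector space with a differential $d$ of degree $+1$ and a graded Lie bracket of degree $0$ for which $d$ is a derivation; it is called abelian if its bracket is zero, and homotopy abelian if there are quasi-isomorphisms of DGLAs $L\leftarrow M\rightarrow H$ with $H$ abelian. A semicosimplicial DGLA $L_\bullet$ consists of DGLAs $L_n$, $n\ge 0$, and morphisms of DGLAs (face operators) $\partial_k\colon L_n\to L_{n+1}$, $0\le k\le n+1$, such that $\partial_l\partial_k=\partial_{k+1}\partial_l$ for all $l\le k$. Let $\Omega_n$ be the polynomial de Rham algebra of the standard $n$-simplex, i.e. the commutative differential graded algebra generated by $t_0,\ldots,t_n$ in degree $0$ and $dt_0,\ldots,dt_n$ in degree $1$ subject to $\sum t_i=1$ and $\sum dt_i=0$, and let $\partial_k^*\colon\Omega_n\to\Omega_{n-1}$ be the morphism with $t_j\mapsto t_j$ for $j<k$, $t_k\mapsto 0$ and $t_j\mapsto t_{j-1}$ for $j>k$. The Thom–Whitney totalization of $L_\bullet$ is the DGLA $$\operatorname{Tot}(L_\bullet)=\Big\{(x_n)\in\prod_{n\ge0}\Omega_n\otimes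 L_n\;\Big|\;(\partial_k^*\otimes \mathrm{Id})x_n=(\mathrm{Id}\otimes\partial_k)x_{n-1}\text{ for all } n\ge 1,\ 0\le k\le n\Big\},$$ where the product is taken in each degree separately, and where the differential and the bracket are the componentwise ones, given on $\Omega_n\otimes L_n$ by $d(\omega\otimes a)=d\omega\otimes a+(-1)^{\bar\omega}\omega\otimes da$ and $[\omega\otimes a,\eta\otimes b]=(-1)^{\bar a\,\bar\eta}\,\omega\eta\otimes[a,b]$. Here $\bar x$ denotes the degree of a homogeneous element $x$. Let $L_\bullet$ be a semicosimplicial DGLA over $\mathbb{K}$, and let $h_n\colon L_n\times L_n\to L_n$, $n\ge 0$, be bilinear maps of degree $-1$ such that, for every $n$ and all homogeneous $a,b,c\in L_n$, 1. $h_n(a,b)=-(-1)^{\bar a\,\bar b}h_n(b,a)$, 2. $[a,b]=d\,h_n(a,b)+h_n(da,b)+(-1)^{\bar a}h_n(a,db)$, 3. $\oint[h_n(a,b),c]+\oint h_n([a,b],c)=0$, where $\oint f(a,b,c)=f(a,b,c)+(-1)^{\bar a(\bar b+\bar c)}f(b,c,a)+(-1)^{\bar c(\bar a+\bar b)}f(c,a,b)$,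 and such that $h_{n+1}(\partial_k a,\partial_k b)=\partial_k h_n(a,b)$ for every $n$, every face operator $\partial_k\colon L_n\to L_{n+1}$ and all $a,b\in L_n$. Then the DGLA $\operatorname{Tot}(L_\bullet)$ is homotopy abelian. -/

import Mathlib

open scoped TensorProduct DirectSum

universe u v w

noncomputable section

/-! ## Differential graded Lie algebras

A `ℤ`-graded object is given by its homogeneous components. Structure maps take the degree of
their value as an argument, together with a proof that it is the right one. The sign `(-1)ⁿ` is
`n.negOnePow`. -/

/-- A differential graded Lie algebra over `K`: a `ℤ`-graded vector space with a differential of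
degree `+1` and a graded Lie bracket of degree `0` for which the differential is a derivation. -/
structure DGLA (K : Type u) [Field K] where
  /-- The homogeneous component of degree `i`. -/
  V : ℤ → Type v
  [addCommGroup : ∀ i, AddCommGroup (V i)]
  [module : ∀ i, Module K (V i)]
  /-- The differential. -/
  d : ∀ i j : ℤ, i + 1 = j → (V i →ₗ[K] V j)
  /-- The bracket. -/
  br : ∀ i j k : ℤ, i + j = k → (V i →ₗ[K] V j →ₗ[K] V k)
  d_d : ∀ (i j k : ℤ) (hij : i + 1 = j) (hjk : j + 1 = k) (a : V i),
    d j k hjk (d i j hij a) = 0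
  /-- `[a,b] = -(-1)^{|a||b|} [b,a]` -/
  skew : ∀ (i j k : ℤ) (hij : i + j = k) (hji : j + i = k) (a : V i) (b : V j),
    br i j k hij a b = -((i * j).negOnePow • br j i k hji b a)
  /-- `[a,[b,c]] = [[a,b],c] + (-1)^{|a||b|} [b,[a,c]]` -/
  jacobi : ∀ (i j k ij jk ik s : ℤ) (hij : i + j = ij) (hjk : j + k = jk) (hik : i + k = ik)
    (h₁ : i + jk = s) (h₂ : ij + k = s) (h₃ : j + ik = s) (a : V i) (b : V j) (c : V k),
    br i jk s h₁ a (br j k jk hjk b c) =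
      br ij k s h₂ (br i j ij hij a b) c +
        (i * j).negOnePow • br j ik s h₃ b (br i k ik hik a c)
  /-- `d[a,b] = [da,b] + (-1)^{|a|} [a,db]` -/
  leibniz : ∀ (i j k i' j' k' : ℤ) (hij : i + j = k) (hi : i + 1 = i') (hj : j + 1 = j')
    (hk : k + 1 = k') (h₁ : i' + j = k') (h₂ : i + j' = k') (a : V i) (b : V j),
    d k k' hk (br i j k hij a b) =
      br i' j k' h₁ (d i i' hi a) b + i.negOnePow • br i j' k' h₂ a (d j j' hj b)

attribute [instance] DGLA.addCommGroup DGLA.module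

namespace DGLA

/-- Morphisms of DGLAs. -/
structure Hom {K : Type u} [Field K] (L : DGLA.{u, v} K) (M : DGLA.{u, w} K) where
  /-- The component in degree `i`. -/
  f : ∀ i : ℤ, L.V i →ₗ[K] M.V i
  map_d : ∀ (i j : ℤ) (h : i + 1 = j) (a : L.V i), f j (L.d i j h a) = M.d i j h (f i a)
  map_br : ∀ (i j k : ℤ) (h : i + j = k) (a : L.V i) (b : L.V j),
    f k (L.br i j k h a b) = M.br i j k h (f i a) (f j b)

/-- The cocycles of degree `i`. -/
def cocycles {K : Type u} [Field K] (L : DGLA.{u, v} K) (i : ℤ) : Submodule K (L.V i) :=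
  LinearMap.ker (L.d i (i + 1) rfl)

/-- The coboundaries of degree `i`. -/
def coboundaries {K : Type u} [Field K] (L : DGLA.{u, v} K) (i : ℤ) : Submodule K (L.V i) :=
  LinearMap.range (L.d (i - 1) i (by omega))

/-- The cohomology space in degree `i`: cocycles modulo coboundaries. -/
abbrev cohomology {K : Type u} [Field K] (L : DGLA.{u, v} K) (i : ℤ) : Type v :=
  L.cocycles i ⧸ (L.coboundaries i).submoduleOf (L.cocycles i)

/-- The restriction of a morphism to cocycles. -/
def Hom.cocyclesMap {K : Type u} [Field K] {L : DGLA.{u, v} K} {M : DGLA.{u, w} K}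
    (φ : Hom L M) (i : ℤ) : L.cocycles i →ₗ[K] M.cocycles i :=
  (φ.f i).restrict (fun a ha => by
    have ha' : L.d i (i + 1) rfl a = 0 := ha
    change M.d i (i + 1) rfl (φ.f i a) = 0
    rw [← φ.map_d, ha', map_zero])

/-- The map induced by a morphism in cohomology. -/
def Hom.cohomologyMap {K : Type u} [Field K] {L : DGLA.{u, v} K} {M : DGLA.{u, w} K}
    (φ : Hom L M) (i : ℤ) : L.cohomology i →ₗ[K] M.cohomology i :=
  Submodule.mapQ _ _ (φ.cocyclesMap i) (by
    rintro ⟨a, ha⟩ ⟨b, hb⟩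
    exact ⟨φ.f _ b, by rw [← φ.map_d, hb]; rfl⟩)

/-- A quasi-isomorphism is a morphism inducing an isomorphism in cohomology. -/
def Hom.IsQuasiIso {K : Type u} [Field K] {L : DGLA.{u, v} K} {M : DGLA.{u, w} K}
    (φ : Hom L M) : Prop :=
  ∀ i : ℤ, Function.Bijective (φ.cohomologyMap i)

/-- A DGLA is abelian if its bracket is trivial. -/
def IsAbelian {K : Type u} [Field K] (H : DGLA.{u, v} K) : Prop :=
  ∀ (i j k : ℤ) (h : i + j = k) (a : H.V i) (b : H.V j), H.br i j k h a b = 0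

/-- `L` is homotopy abelian if there are quasi-isomorphisms of DGLAs `L ← M → H` with `H`
abelian. -/
def IsHomotopyAbelian {K : Type u} [Field K] (L : DGLA.{u, v} K) : Prop :=
  ∃ (M H : DGLA.{u, v} K) (f : Hom M L) (g : Hom M H),
    f.IsQuasiIso ∧ g.IsQuasiIso ∧ H.IsAbelian

/-- Bilinear maps `L × L → L` of degree `-1`, as families of bilinear maps between the homogeneous
components. -/
abbrev BilinNegOne {K : Type u} [Field K] (L : DGLA.{u, v} K) : Type v :=
  ∀ i j k : ℤ, i + j - 1 = k → (L.V i →ₗ[K] L.V j →ₗ[K] L.V k)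

/-- The conditions on a bilinear map `h : L × L → L` of degree `-1` in the abelianity criterion. -/
structure IsAbelianityHomotopy {K : Type u} [Field K] (L : DGLA.{u, v} K)
    (h : L.BilinNegOne) : Prop where
  /-- `h(a,b) = -(-1)^{|a||b|} h(b,a)` -/
  skew : ∀ (i j k : ℤ) (hij : i + j - 1 = k) (a : L.V i) (b : L.V j),
    h i j k hij a b = -((i * j).negOnePow • h j i k (by omega) b a)
  /-- `[a,b] = d h(a,b) + h(da,b) + (-1)^{|a|} h(a,db)` -/
  bracket : ∀ (i j k : ℤ) (hij : i + j = k) (a : L.V i) (b : L.V j),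
    L.br i j k hij a b =
      L.d (k - 1) k (by omega) (h i j (k - 1) (by omega) a b)
        + h (i + 1) j k (by omega) (L.d i (i + 1) rfl a) b
        + i.negOnePow • h i (j + 1) k (by omega) a (L.d j (j + 1) rfl b)
  /-- `∮ [h(a,b),c] + ∮ h([a,b],c) = 0`, where `∮ f(a,b,c)` is the cyclic sum
  `f(a,b,c) + (-1)^{|a|(|b|+|c|)} f(b,c,a) + (-1)^{|c|(|a|+|b|)} f(c,a,b)`. -/
  cyclic : ∀ (i j k s : ℤ) (hs : i + j + k - 1 = s) (a : L.V i) (b : L.V j) (c : L.V k),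
    (L.br (i + j - 1) k s (by omega) (h i j (i + j - 1) rfl a b) c
      + (i * (j + k)).negOnePow •
          L.br (j + k - 1) i s (by omega) (h j k (j + k - 1) rfl b c) a
      + (k * (i + j)).negOnePow •
          L.br (k + i - 1) j s (by omega) (h k i (k + i - 1) rfl c a) b)
    + (h (i + j) k s (by omega) (L.br i j (i + j) rfl a b) c
      + (i * (j + k)).negOnePow •
          h (j + k) i s (by omega) (L.br j k (j + k) rfl b c) a
      + (k * (i + j)).negOnePow •
          h (k + i) j s (by omega) (L.br k i (k + i) rfl c a) b) = 0

end DGLA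

/-! ## Commutative differential graded algebras -/

/-- A (graded) commutative differential graded algebra over `K`. -/
structure CDGA (K : Type u) [Field K] where
  /-- The homogeneous component of degree `i`. -/
  V : ℤ → Type v
  [addCommGroup : ∀ i, AddCommGroup (V i)]
  [module : ∀ i, Module K (V i)]
  /-- The differential. -/
  d : ∀ i j : ℤ, i + 1 = j → (V i →ₗ[K] V j)
  /-- The unit. -/
  one : V 0
  /-- The product. -/
  mul : ∀ i j k : ℤ, i + j = k → (V i →ₗ[K] V j →ₗ[K] V k)
  d_d : ∀ (i j k : ℤ) (hij : i + 1 = j) (hjk : j + 1 = k) (a : V i),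
    d j k hjk (d i j hij a) = 0
  one_mul : ∀ (i : ℤ) (h : 0 + i = i) (a : V i), mul 0 i i h one a = a
  mul_assoc : ∀ (i j k ij jk s : ℤ) (hij : i + j = ij) (hjk : j + k = jk)
    (h₁ : ij + k = s) (h₂ : i + jk = s) (a : V i) (b : V j) (c : V k),
    mul ij k s h₁ (mul i j ij hij a b) c = mul i jk s h₂ a (mul j k jk hjk b c)
  /-- `a b = (-1)^{|a||b|} b a` -/
  mul_comm : ∀ (i j k : ℤ) (hij : i + j = k) (hji : j + i = k) (a : V i) (b : V j),
    mul i j k hij a b = (i * j).negOnePow • mul j i k hji b a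
  /-- `d(a b) = (da) b + (-1)^{|a|} a (db)` -/
  leibniz : ∀ (i j k i' j' k' : ℤ) (hij : i + j = k) (hi : i + 1 = i') (hj : j + 1 = j')
    (hk : k + 1 = k') (h₁ : i' + j = k') (h₂ : i + j' = k') (a : V i) (b : V j),
    d k k' hk (mul i j k hij a b) =
      mul i' j k' h₁ (d i i' hi a) b + i.negOnePow • mul i j' k' h₂ a (d j j' hj b)

attribute [instance] CDGA.addCommGroup CDGA.module

/-- Morphisms of commutative differential graded algebras. -/
structure CDGA.Hom {K : Type u} [Field K] (P : CDGA.{u, v} K) (Q : CDGA.{u, w} K) where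
  /-- The component in degree `i`. -/
  f : ∀ i : ℤ, P.V i →ₗ[K] Q.V i
  map_d : ∀ (i j : ℤ) (h : i + 1 = j) (a : P.V i), f j (P.d i j h a) = Q.d i j h (f i a)
  map_one : f 0 P.one = Q.one
  map_mul : ∀ (i j k : ℤ) (h : i + j = k) (a : P.V i) (b : P.V j),
    f k (P.mul i j k h a b) = Q.mul i j k h (f i a) (f j b)

/-! ## The tensor product of a CDGA and a DGLA -/

namespace CDGATensor

section

variable {K : Type u} [Field K] (P : CDGA.{u, w} K) (L : DGLA.{u, v} K)

/-- The component of degree `p` of `P ⊗ L`, the direct sum of all `Pⁱ ⊗ Lʲ` with `i + j = p`. -/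
abbrev V (p : ℤ) : Type (max w v) :=
  ⨁ x : {x : ℤ × ℤ // x.1 + x.2 = p}, P.V x.1.1 ⊗[K] L.V x.1.2

/-- The inclusion of `Pⁱ ⊗ Lʲ` in `(P ⊗ L)ᵖ`, for `i + j = p`. -/
def incl (i j p : ℤ) (h : i + j = p) : P.V i ⊗[K] L.V j →ₗ[K] V P L p :=
  DirectSum.lof K {x : ℤ × ℤ // x.1 + x.2 = p} (fun x => P.V x.1.1 ⊗[K] L.V x.1.2) ⟨(i, j), h⟩

/-- The differential `d(ω ⊗ a) = dω ⊗ a + (-1)^{|ω|} ω ⊗ da`. -/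
def d (p q : ℤ) (h : p + 1 = q) : V P L p →ₗ[K] V P L q :=
  DirectSum.toModule K _ _ fun x =>
    incl P L (x.1.1 + 1) x.1.2 q (by have := x.2; omega) ∘ₗ
        TensorProduct.map (P.d x.1.1 (x.1.1 + 1) rfl) LinearMap.id
      + x.1.1.negOnePow • (incl P L x.1.1 (x.1.2 + 1) q (by have := x.2; omega) ∘ₗ
        TensorProduct.map LinearMap.id (L.d x.1.2 (x.1.2 + 1) rfl))

/-- The bracket `[ω ⊗ a, η ⊗ b] = (-1)^{|a||η|} ωη ⊗ [a,b]`. -/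
def br (p q r : ℤ) (h : p + q = r) : V P L p →ₗ[K] V P L q →ₗ[K] V P L r :=
  DirectSum.toModule K _ _ fun x => LinearMap.flip <| DirectSum.toModule K _ _ fun y =>
    LinearMap.flip <|
      (TensorProduct.map₂ (P.mul x.1.1 y.1.1 (x.1.1 + y.1.1) rfl)
        (L.br x.1.2 y.1.2 (x.1.2 + y.1.2) rfl)).compr₂
      ((x.1.2 * y.1.1).negOnePow • incl P L (x.1.1 + y.1.1) (x.1.2 + y.1.2) r
        (by have := x.2; have := y.2; omega))

variable {P L}

theorem induction {p : ℤ} {C : V P L p → Prop} (x : V P L p) (zero : C 0)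
    (add : ∀ x y, C x → C y → C (x + y))
    (pure : ∀ (i j : ℤ) (h : i + j = p) (ω : P.V i) (a : L.V j), C (incl P L i j p h (ω ⊗ₜ a))) :
    C x := by
  induction x using DirectSum.induction_on with
  | zero => exact zero
  | add x y hx hy => exact add x y hx hy
  | of x t =>
    obtain ⟨⟨i, j⟩, h⟩ := x
    induction t using TensorProduct.induction_on with
    | zero => rw [map_zero]; exact zero
    | add s t hs ht => rw [map_add]; exact add _ _ hs ht
    | tmul ω a => exact pure i j h ω a

theorem toModule_incl {N : Type*} [AddCommMonoid N] [Module K N] {p : ℤ}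
    (φ : ∀ x : {x : ℤ × ℤ // x.1 + x.2 = p}, P.V x.1.1 ⊗[K] L.V x.1.2 →ₗ[K] N)
    (i j : ℤ) (h : i + j = p) (t : P.V i ⊗[K] L.V j) :
    DirectSum.toModule K _ N φ (incl P L i j p h t) = φ ⟨(i, j), h⟩ t :=
  DirectSum.toModule_lof ..

theorem d_incl (p q : ℤ) (h : p + 1 = q) (i j : ℤ) (hij : i + j = p) (i' j' : ℤ)
    (hi : i + 1 = i') (hj : j + 1 = j') (h₁ : i' + j = q) (h₂ : i + j' = q)
    (ω : P.V i) (a : L.V j) :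
    d P L p q h (incl P L i j p hij (ω ⊗ₜ a)) =
      incl P L i' j q h₁ (P.d i i' hi ω ⊗ₜ a) +
        i.negOnePow • incl P L i j' q h₂ (ω ⊗ₜ L.d j j' hj a) := by
  subst hi hj
  simp only [d]
  rw [toModule_incl]
  simp [Units.smul_def]

theorem br_incl (p q r : ℤ) (h : p + q = r) (i j i' j' i'' j'' : ℤ) (hij : i + j = p)
    (hij' : i' + j' = q) (hi : i + i' = i'') (hj : j + j' = j'') (h'' : i'' + j'' = r)
    (ω : P.V i) (a : L.V j) (η : P.V i') (b : L.V j') :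
    br P L p q r h (incl P L i j p hij (ω ⊗ₜ a)) (incl P L i' j' q hij' (η ⊗ₜ b)) =
      (j * i').negOnePow • incl P L i'' j'' r h''
        (P.mul i i' i'' hi ω η ⊗ₜ L.br j j' j'' hj a b) := by
  subst hi hj
  simp only [br]
  rw [toModule_incl, LinearMap.flip_apply, toModule_incl]
  simp [Units.smul_def]

theorem map_sign {M N : Type*} [AddCommGroup M] [AddCommGroup N] [Module K M] [Module K N]
    (f : M →ₗ[K] N) (e : ℤˣ) (x : M) : f (e • x) = e • f x := by
  simp [Units.smul_def]

theorem map_sign₂ {M N Q : Type*} [AddCommGroup M] [AddCommGroup N] [AddCommGroup Q]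
    [Module K M] [Module K N] [Module K Q]
    (f : M →ₗ[K] N →ₗ[K] Q) (e : ℤˣ) (x : M) (y : N) : f (e • x) y = e • f x y := by
  simp [Units.smul_def]

theorem sign_tmul {M N : Type*} [AddCommGroup M] [AddCommGroup N] [Module K M] [Module K N]
    (e : ℤˣ) (x : M) (y : N) : (e • x) ⊗ₜ[K] y = e • (x ⊗ₜ[K] y) :=
  map_sign₂ (TensorProduct.mk K M N) e x y

theorem tmul_sign {M N : Type*} [AddCommGroup M] [AddCommGroup N] [Module K M] [Module K N]
    (e : ℤˣ) (x : M) (y : N) : x ⊗ₜ[K] (e • y) = e • (x ⊗ₜ[K] y) :=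
  map_sign (TensorProduct.mk K M N x) e y

theorem d_d (p q r : ℤ) (h : p + 1 = q) (h' : q + 1 = r) (x : V P L p) :
    d P L q r h' (d P L p q h x) = 0 := by
  induction x using induction with
  | zero => simp
  | add x y hx hy => simp [hx, hy]
  | pure i j hij ω a =>
    rw [d_incl p q h i j hij _ _ rfl rfl (by omega) (by omega), map_add, map_sign,
      d_incl q r h' (i + 1) j _ _ _ rfl rfl (by omega) (by omega),
      d_incl q r h' i (j + 1) _ _ _ rfl rfl (by omega) (by omega), P.d_d, L.d_d]
    simp [Int.negOnePow_succ]

theorem skew (p q r : ℤ) (h : p + q = r) (h' : q + p = r) (x : V P L p) (y : V P L q) :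
    br P L p q r h x y = -((p * q).negOnePow • br P L q p r h' y x) := by
  induction x using induction with
  | zero => simp
  | add x x' hx hx' => simp only [map_add, LinearMap.add_apply, hx, hx', smul_add, neg_add]
  | pure i j hij ω a =>
    induction y using induction with
    | zero => simp
    | add y y' hy hy' => simp only [map_add, LinearMap.add_apply, hy, hy', smul_add, neg_add]
    | pure k l hkl η b =>
      rw [br_incl p q r h i j k l (i + k) (j + l) _ _ rfl rfl (by omega),
        br_incl q p r h' k l i j (i + k) (j + l) _ _ (by omega) (by omega) (by omega),
        P.mul_comm i k _ rfl (by omega), L.skew j l _ rfl (by omega),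
        sign_tmul, TensorProduct.tmul_neg, tmul_sign, smul_neg, map_neg, smul_neg]
      simp only [map_sign, smul_smul, ← Int.negOnePow_add]
      congr 2
      rw [Int.negOnePow_eq_iff]
      subst hij hkl
      exact ⟨-(i * l), by ring⟩

theorem leibniz (p q r p' q' r' : ℤ) (h : p + q = r) (hp : p + 1 = p') (hq : q + 1 = q')
    (hr : r + 1 = r') (h₁ : p' + q = r') (h₂ : p + q' = r') (x : V P L p) (y : V P L q) :
    d P L r r' hr (br P L p q r h x y) =
      br P L p' q r' h₁ (d P L p p' hp x) y + p.negOnePow • br P L p q' r' h₂ x (d P L q q' hq y)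
    := by
  induction x using induction with
  | zero => simp
  | add x x' hx hx' => simp only [map_add, LinearMap.add_apply, hx, hx', smul_add]; abel
  | pure i j hij ω a =>
    induction y using induction with
    | zero => simp
    | add y y' hy hy' => simp only [map_add, hy, hy', smul_add]; abel
    | pure k l hkl η b =>
      rw [br_incl p q r h i j k l (i + k) (j + l) _ _ rfl rfl (by omega), map_sign,
        d_incl r r' hr (i + k) (j + l) _ (i + k + 1) (j + l + 1) rfl rfl (by omega) (by omega),
        d_incl p p' hp i j _ (i + 1) (j + 1) rfl rfl (by omega) (by omega),
        d_incl q q' hq k l _ (k + 1) (l + 1) rfl rfl (by omega) (by omega),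
        P.leibniz i k _ (i + 1) (k + 1) (i + k + 1) rfl rfl rfl rfl (by omega) (by omega),
        L.leibniz j l _ (j + 1) (l + 1) (j + l + 1) rfl rfl rfl rfl (by omega) (by omega)]
      simp only [map_add, map_sign, map_sign₂, LinearMap.add_apply]
      rw [br_incl p' q r' h₁ (i + 1) j k l (i + k + 1) (j + l) _ _ (by omega) (by omega) (by omega),
        br_incl p' q r' h₁ i (j + 1) k l (i + k) (j + l + 1) _ _ (by omega) (by omega) (by omega),
        br_incl p q' r' h₂ i j (k + 1) l (i + k + 1) (j + l) _ _ (by omega) (by omega) (by omega),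
        br_incl p q' r' h₂ i j k (l + 1) (i + k) (j + l + 1) _ _ (by omega) (by omega) (by omega)]
      simp only [TensorProduct.add_tmul, TensorProduct.tmul_add, sign_tmul, tmul_sign, map_add,
        map_sign, smul_add, smul_smul, ← Int.negOnePow_add]
      have e₁ : (j * k + i).negOnePow = (p + j * (k + 1)).negOnePow := by
        rw [Int.negOnePow_eq_iff]
        subst hij
        exact ⟨-j, by ring⟩
      have e₂ : (j * k + (i + k)).negOnePow = (i + (j + 1) * k).negOnePow := by
        congr 1; ring
      have e₃ : (j * k + (i + k + j)).negOnePow = (p + (k + j * k)).negOnePow := by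
        subst hij; congr 1; ring
      rw [e₁, e₂, e₃]
      abel

theorem jacobi (p q r pq qr pr s : ℤ) (hpq : p + q = pq) (hqr : q + r = qr) (hpr : p + r = pr)
    (h₁ : p + qr = s) (h₂ : pq + r = s) (h₃ : q + pr = s)
    (x : V P L p) (y : V P L q) (z : V P L r) :
    br P L p qr s h₁ x (br P L q r qr hqr y z) =
      br P L pq r s h₂ (br P L p q pq hpq x y) z +
        (p * q).negOnePow • br P L q pr s h₃ y (br P L p r pr hpr x z) := by
  induction x using induction with
  | zero => simp
  | add x x' hx hx' => simp only [map_add, LinearMap.add_apply, hx, hx', smul_add]; abel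
  | pure i j hij ω a =>
  induction y using induction with
  | zero => simp
  | add y y' hy hy' => simp only [map_add, LinearMap.add_apply, hy, hy', smul_add]; abel
  | pure k l hkl η b =>
  induction z using induction with
  | zero => simp
  | add z z' hz hz' => simp only [map_add, hz, hz', smul_add]; abel
  | pure m n hmn ζ c =>
    rw [br_incl q r qr hqr k l m n (k + m) (l + n) _ _ rfl rfl (by omega),
      br_incl p q pq hpq i j k l (i + k) (j + l) _ _ rfl rfl (by omega),
      br_incl p r pr hpr i j m n (i + m) (j + n) _ _ rfl rfl (by omega)]
    simp only [map_sign, map_sign₂]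
    rw [br_incl p qr s h₁ i j (k + m) (l + n) (i + k + m) (j + l + n) _ _
        (by omega) (by omega) (by omega),
      br_incl pq r s h₂ (i + k) (j + l) m n (i + k + m) (j + l + n) _ _
        (by omega) (by omega) (by omega),
      br_incl q pr s h₃ k l (i + m) (j + n) (i + k + m) (j + l + n) _ _
        (by omega) (by omega) (by omega),
      L.jacobi j l n (j + l) (l + n) (j + n) (j + l + n) rfl rfl rfl _ rfl (by omega)]
    have e : P.mul i (k + m) (i + k + m) (by omega) ω (P.mul k m (k + m) rfl η ζ) =
        (i * k).negOnePow •
          P.mul k (i + m) (i + k + m) (by omega) η (P.mul i m (i + m) rfl ω ζ) := by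
      rw [← P.mul_assoc i k m (i + k) _ _ rfl rfl rfl, ← P.mul_assoc k i m (i + k) _ _ (by omega)
        rfl rfl, P.mul_comm i k _ rfl (by omega), map_sign₂]
    rw [TensorProduct.tmul_add, map_add, P.mul_assoc i k m (i + k) (k + m) _ rfl rfl rfl (by omega),
      smul_add, smul_add]
    congr 1
    · simp only [smul_smul, ← Int.negOnePow_add]
      congr 2
      ring
    · rw [e]
      simp only [sign_tmul, tmul_sign, map_sign, smul_smul, ← Int.negOnePow_add]
      congr 1
      rw [Int.negOnePow_eq_iff]
      subst hij hkl hmn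
      exact ⟨-(i * l), by ring⟩

/-- The map `f ⊗ g : (P ⊗ L)ᵖ → (Q ⊗ M)ᵖ` given by `ω ⊗ a ↦ f ω ⊗ g a`. -/
def map {Q : CDGA.{u, w} K} {M : DGLA.{u, v} K} (f : CDGA.Hom P Q) (g : DGLA.Hom L M) (p : ℤ) :
    V P L p →ₗ[K] V Q M p :=
  DirectSum.toModule K _ _ fun x =>
    incl Q M x.1.1 x.1.2 p x.2 ∘ₗ TensorProduct.map (f.f x.1.1) (g.f x.1.2)

theorem map_incl {Q : CDGA.{u, w} K} {M : DGLA.{u, v} K} (f : CDGA.Hom P Q) (g : DGLA.Hom L M)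
    (p i j : ℤ) (h : i + j = p) (ω : P.V i) (a : L.V j) :
    map f g p (incl P L i j p h (ω ⊗ₜ a)) = incl Q M i j p h (f.f i ω ⊗ₜ g.f j a) := by
  rw [map, toModule_incl]
  rfl

theorem map_d {Q : CDGA.{u, w} K} {M : DGLA.{u, v} K} (f : CDGA.Hom P Q) (g : DGLA.Hom L M)
    (p q : ℤ) (h : p + 1 = q) (x : V P L p) :
    map f g q (d P L p q h x) = d Q M p q h (map f g p x) := by
  induction x using induction with
  | zero => simp
  | add x y hx hy => simp only [map_add, hx, hy]
  | pure i j hij ω a =>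
    rw [d_incl p q h i j hij _ _ rfl rfl (by omega) (by omega), map_add, map_sign,
      map_incl, map_incl, map_incl,
      d_incl p q h i j hij _ _ rfl rfl (by omega) (by omega), f.map_d, g.map_d]

theorem map_br {Q : CDGA.{u, w} K} {M : DGLA.{u, v} K} (f : CDGA.Hom P Q) (g : DGLA.Hom L M)
    (p q r : ℤ) (h : p + q = r) (x : V P L p) (y : V P L q) :
    map f g r (br P L p q r h x y) = br Q M p q r h (map f g p x) (map f g q y) := by
  induction x using induction with
  | zero => simp
  | add x x' hx hx' => simp only [map_add, LinearMap.add_apply, hx, hx']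
  | pure i j hij ω a =>
    induction y using induction with
    | zero => simp
    | add y y' hy hy' => simp only [map_add, hy, hy']
    | pure k l hkl η b =>
      rw [br_incl p q r h i j k l (i + k) (j + l) _ _ rfl rfl (by omega), map_sign,
        map_incl, map_incl, map_incl,
        br_incl p q r h i j k l (i + k) (j + l) _ _ rfl rfl (by omega), f.map_mul, g.map_br]

end

end CDGATensor

/-- The DGLA `P ⊗ L`. -/
def DGLA.tensor {K : Type u} [Field K] (P : CDGA.{u, w} K) (L : DGLA.{u, v} K) :
    DGLA.{u, max w v} K where
  V := CDGATensor.V P L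
  d := CDGATensor.d P L
  br := CDGATensor.br P L
  d_d := CDGATensor.d_d
  skew := CDGATensor.skew
  jacobi := CDGATensor.jacobi
  leibniz := CDGATensor.leibniz

/-- The morphism `f ⊗ g : P ⊗ L → Q ⊗ M` given by `ω ⊗ a ↦ f ω ⊗ g a`. -/
def DGLA.Hom.tensor {K : Type u} [Field K] {P Q : CDGA.{u, w} K} {L M : DGLA.{u, v} K}
    (f : CDGA.Hom P Q) (g : DGLA.Hom L M) : DGLA.Hom (DGLA.tensor P L) (DGLA.tensor Q M) where
  f := CDGATensor.map f g
  map_d := CDGATensor.map_d f g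
  map_br := CDGATensor.map_br f g

/-- The identity morphism. -/
def DGLA.Hom.id {K : Type u} [Field K] (L : DGLA.{u, v} K) : DGLA.Hom L L where
  f _ := LinearMap.id
  map_d _ _ _ _ := rfl
  map_br _ _ _ _ _ _ := rfl

/-- The identity morphism. -/
def CDGA.Hom.id {K : Type u} [Field K] (P : CDGA.{u, v} K) : CDGA.Hom P P where
  f _ := LinearMap.id
  map_d _ _ _ _ := rfl
  map_one := rfl
  map_mul _ _ _ _ _ _ := rfl

/-! ## Polynomial differential forms on the standard simplices -/

namespace SimplexForms

section

variable (K : Type u) [Field K] (n : ℕ)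

/-- The defining relations of the polynomial de Rham algebra of the `n`-simplex, for families
`t₀, …, tₙ` and `dt₀, …, dtₙ` of elements of a `K`-algebra: graded commutativity, and
`t₀ + ⋯ + tₙ = 1`, `dt₀ + ⋯ + dtₙ = 0`. -/
structure Relations {n : ℕ} {B : Type*} [Ring B] (t dt : Fin (n + 1) → B) : Prop where
  t_t : ∀ i j, t i * t j = t j * t i
  t_dt : ∀ i j, t i * dt j = dt j * t i
  dt_dt : ∀ i j, dt i * dt j = -(dt j * dt i)
  dt_sq : ∀ i, dt i * dt i = 0
  sum_t : ∑ i, t i = 1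
  sum_dt : ∑ i, dt i = 0

/-- The set of generators: `Sum.inl i` stands for `tᵢ`, and `Sum.inr i` for `dtᵢ`. -/
abbrev Gen : Type := Fin (n + 1) ⊕ Fin (n + 1)

/-- The relation on the free algebra that is imposed by `Relations`. -/
inductive Rel : FreeAlgebra K (Gen n) → FreeAlgebra K (Gen n) → Prop
  | t_t (i j : Fin (n + 1)) :
    Rel (FreeAlgebra.ι K (.inl i) * FreeAlgebra.ι K (.inl j))
      (FreeAlgebra.ι K (.inl j) * FreeAlgebra.ι K (.inl i))
  | t_dt (i j : Fin (n + 1)) :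
    Rel (FreeAlgebra.ι K (.inl i) * FreeAlgebra.ι K (.inr j))
      (FreeAlgebra.ι K (.inr j) * FreeAlgebra.ι K (.inl i))
  | dt_dt (i j : Fin (n + 1)) :
    Rel (FreeAlgebra.ι K (.inr i) * FreeAlgebra.ι K (.inr j))
      (-(FreeAlgebra.ι K (.inr j) * FreeAlgebra.ι K (.inr i)))
  | dt_sq (i : Fin (n + 1)) :
    Rel (FreeAlgebra.ι K (.inr i) * FreeAlgebra.ι K (.inr i)) 0
  | sum_t : Rel (∑ i, FreeAlgebra.ι K (.inl i)) 1
  | sum_dt : Rel (∑ i, FreeAlgebra.ι K (.inr i)) 0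

/-- The algebra of polynomial differential forms on the `n`-simplex: the `K`-algebra generated by
`t₀, …, tₙ, dt₀, …, dtₙ` subject to `Relations`. -/
def Alg : Type u := RingQuot (Rel K n)

instance : Ring (Alg K n) := inferInstanceAs (Ring (RingQuot (Rel K n)))

instance : Algebra K (Alg K n) := inferInstanceAs (Algebra K (RingQuot (Rel K n)))

variable {n}

/-- The quotient map. -/
def mk : FreeAlgebra K (Gen n) →ₐ[K] Alg K n := RingQuot.mkAlgHom K (Rel K n)

theorem mk_rel {a b : FreeAlgebra K (Gen n)} (h : Rel K n a b) : mk K a = mk K b :=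
  RingQuot.mkAlgHom_rel K h

/-- The class of a generator. -/
def gen (g : Gen n) : Alg K n := mk K (FreeAlgebra.ι K g)

/-- The form `tᵢ`. -/
def t (i : Fin (n + 1)) : Alg K n := gen K (.inl i)

/-- The form `dtᵢ`. -/
def dt (i : Fin (n + 1)) : Alg K n := gen K (.inr i)

theorem relations : Relations (t K : Fin (n + 1) → Alg K n) (dt K) where
  t_t i j := by simpa [t, gen] using mk_rel K (Rel.t_t (K := K) i j)
  t_dt i j := by simpa [t, dt, gen] using mk_rel K (Rel.t_dt (K := K) i j)
  dt_dt i j := by simpa [dt, gen] using mk_rel K (Rel.dt_dt (K := K) i j)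
  dt_sq i := by simpa [dt, gen] using mk_rel K (Rel.dt_sq (K := K) i)
  sum_t := by simpa [t, gen] using mk_rel K (Rel.sum_t (K := K) (n := n))
  sum_dt := by simpa [dt, gen] using mk_rel K (Rel.sum_dt (K := K) (n := n))

variable {K}

/-- The universal property: families in `B` that satisfy `Relations` define a homomorphism to
`B`. -/
def lift {B : Type*} [Ring B] [Algebra K B] (x dx : Fin (n + 1) → B) (h : Relations x dx) :
    Alg K n →ₐ[K] B :=
  RingQuot.liftAlgHom K ⟨FreeAlgebra.lift K (Sum.elim x dx), by
    intro a b hab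
    cases hab with
    | t_t i j => simpa using h.t_t i j
    | t_dt i j => simpa using h.t_dt i j
    | dt_dt i j => simpa using h.dt_dt i j
    | dt_sq i => simpa using h.dt_sq i
    | sum_t => simpa using h.sum_t
    | sum_dt => simpa using h.sum_dt⟩

@[simp]
theorem lift_t {B : Type*} [Ring B] [Algebra K B] (x dx : Fin (n + 1) → B) (h : Relations x dx)
    (i : Fin (n + 1)) : lift (K := K) x dx h (t K i) = x i :=
  (RingQuot.liftAlgHom_mkAlgHom_apply ..).trans (by simp)

@[simp]
theorem lift_dt {B : Type*} [Ring B] [Algebra K B] (x dx : Fin (n + 1) → B) (h : Relations x dx)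
    (i : Fin (n + 1)) : lift (K := K) x dx h (dt K i) = dx i :=
  (RingQuot.liftAlgHom_mkAlgHom_apply ..).trans (by simp)

/-- The parity automorphism `ω ↦ (-1)^{|ω|} ω`. -/
def parity : Alg K n →ₐ[K] Alg K n :=
  lift (t K) (fun i => -dt K i)
    { t_t := (relations K).t_t
      t_dt := fun i j => by rw [mul_neg, neg_mul, (relations K).t_dt]
      dt_dt := fun i j => by rw [neg_mul_neg, neg_mul_neg, (relations K).dt_dt]
      dt_sq := fun i => by rw [neg_mul_neg, (relations K).dt_sq]
      sum_t := (relations K).sum_t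
      sum_dt := by rw [Finset.sum_neg_distrib, (relations K).sum_dt, neg_zero] }

/-- The homomorphism whose upper right entry is the de Rham differential: for a linear map `d`,
the map `ω ↦ !![(-1)^{|ω|} ω, dω; 0, ω]` is multiplicative if and only if
`d(ωη) = (dω)η + (-1)^{|ω|} ω(dη)`. -/
def dMatrix : Alg K n →ₐ[K] Matrix (Fin 2) (Fin 2) (Alg K n) :=
  lift (fun i => !![t K i, dt K i; 0, t K i]) (fun i => !![-dt K i, 0; 0, dt K i])
    { t_t := fun i j => by
        simp only [Matrix.mul_fin_two, mul_zero, zero_mul, add_zero, zero_add]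
        rw [(relations K).t_t i j, (relations K).t_dt i j, (relations K).t_dt j i, add_comm]
      t_dt := fun i j => by
        simp only [Matrix.mul_fin_two, mul_zero, zero_mul, add_zero, zero_add, mul_neg, neg_mul,
          neg_zero]
        rw [(relations K).t_dt i j, (relations K).dt_dt i j]
      dt_dt := fun i j => by
        simp only [Matrix.mul_fin_two, mul_zero, zero_mul, add_zero, zero_add, neg_mul_neg]
        rw [(relations K).dt_dt i j]
        ext a b
        fin_cases a <;> fin_cases b <;> simp
      dt_sq := fun i => by
        simp only [Matrix.mul_fin_two, mul_zero, zero_mul, add_zero, zero_add, neg_mul_neg]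
        rw [(relations K).dt_sq i]
        ext a b
        fin_cases a <;> fin_cases b <;> simp
      sum_t := by
        ext a b
        rw [Matrix.sum_apply]
        fin_cases a <;> fin_cases b <;> simp [(relations K).sum_t, (relations K).sum_dt]
      sum_dt := by
        ext a b
        rw [Matrix.sum_apply]
        fin_cases a <;> fin_cases b <;> simp [(relations K).sum_dt] }

/-- The de Rham differential. -/
def d : Alg K n →ₗ[K] Alg K n :=
  Matrix.entryLinearMap K (Alg K n) 0 1 ∘ₗ (dMatrix (K := K) (n := n)).toLinearMap

@[simp]
theorem d_t (i : Fin (n + 1)) : d (t K i) = dt K i := by simp [d, dMatrix]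

@[simp]
theorem d_dt (i : Fin (n + 1)) : d (dt K i) = 0 := by simp [d, dMatrix]

@[simp]
theorem parity_t (i : Fin (n + 1)) : parity (t K i) = t K i := by simp [parity]

@[simp]
theorem parity_dt (i : Fin (n + 1)) : parity (dt K i) = -dt K i := by simp [parity]

@[simp]
theorem d_one : d (1 : Alg K n) = 0 := by simp [d]

/-- The product of a word in the generators. -/
def word (l : List (Gen n)) : Alg K n := (l.map (gen K)).prod

@[simp]
theorem word_nil : word (K := K) ([] : List (Gen n)) = 1 := rfl

@[simp]
theorem word_t (i : Fin (n + 1)) (l : List (Gen n)) :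
    word (K := K) (.inl i :: l) = t K i * word l := by simp [word, t]

@[simp]
theorem word_dt (i : Fin (n + 1)) (l : List (Gen n)) :
    word (K := K) (.inr i :: l) = dt K i * word l := by simp [word, dt]

/-- The degree of a word: the number of its factors of the form `dtᵢ`. -/
def wordDegree (l : List (Gen n)) : ℤ := (l.countP Sum.isRight : ℕ)

@[simp]
theorem wordDegree_nil : wordDegree ([] : List (Gen n)) = 0 := rfl

@[simp]
theorem wordDegree_t (i : Fin (n + 1)) (l : List (Gen n)) :
    wordDegree (.inl i :: l) = wordDegree l := by simp [wordDegree]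

@[simp]
theorem wordDegree_dt (i : Fin (n + 1)) (l : List (Gen n)) :
    wordDegree (.inr i :: l) = wordDegree l + 1 := by
  simp [wordDegree, List.countP_cons]

variable (K n)

/-- The forms of degree `i`: the span of all products of generators that have exactly `i` factors
of the form `dtⱼ`. -/
def forms (i : ℤ) : Submodule K (Alg K n) :=
  Submodule.span K {x | ∃ l : List (Gen n), wordDegree l = i ∧ word l = x}

variable {K n}

theorem word_mem (l : List (Gen n)) (i : ℤ) (h : wordDegree l = i) : word l ∈ forms K n i :=
  Submodule.subset_span ⟨l, h, rfl⟩

theorem word_mul (l m : List (Gen n)) : word (K := K) l * word m = word (l ++ m) := by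
  simp [word]

theorem wordDegree_append (l m : List (Gen n)) :
    wordDegree (l ++ m) = wordDegree l + wordDegree m := by
  simp [wordDegree]

/-- Two linear maps that agree on words agree on forms. -/
theorem eqOn_forms {N : Type*} [AddCommGroup N] [Module K N] {i : ℤ} (f g : Alg K n →ₗ[K] N)
    (h : ∀ l : List (Gen n), wordDegree l = i → f (word l) = g (word l)) {x : Alg K n}
    (hx : x ∈ forms K n i) : f x = g x := by
  refine LinearMap.eqOn_span (s := {x | ∃ l : List (Gen n), wordDegree l = i ∧ word l = x}) ?_ hx
  rintro _ ⟨l, hl, rfl⟩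
  exact h l hl

theorem map_mem_forms {m : ℕ} {i j : ℤ} (f : Alg K n →ₗ[K] Alg K m)
    (h : ∀ l : List (Gen n), wordDegree l = i → f (word l) ∈ forms K m j) {x : Alg K n}
    (hx : x ∈ forms K n i) : f x ∈ forms K m j := by
  have : forms K n i ≤ (forms K m j).comap f := by
    refine Submodule.span_le.2 ?_
    rintro _ ⟨l, hl, rfl⟩
    exact h l hl
  exact this hx

theorem mul_mem {i j k : ℤ} (h : i + j = k) {x y : Alg K n} (hx : x ∈ forms K n i)
    (hy : y ∈ forms K n j) : x * y ∈ forms K n k := by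
  refine map_mem_forms (LinearMap.mulRight K y) (fun l hl => ?_) hx
  refine map_mem_forms (LinearMap.mulLeft K (word l)) (fun m hm => ?_) hy
  rw [LinearMap.mulLeft_apply, word_mul]
  exact word_mem _ _ (by rw [wordDegree_append, hl, hm, h])

theorem t_mem (i : Fin (n + 1)) : t K i ∈ forms K n 0 := by
  simpa using word_mem (K := K) [.inl i] 0 (by simp)

theorem dt_mem (i : Fin (n + 1)) : dt K i ∈ forms K n 1 := by
  simpa using word_mem (K := K) [.inr i] 1 (by simp)

theorem one_mem : (1 : Alg K n) ∈ forms K n 0 := by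
  simpa using word_mem (K := K) ([] : List (Gen n)) 0 (by simp)

theorem parity_word (l : List (Gen n)) :
    parity (word (K := K) l) = (wordDegree l).negOnePow • word l := by
  induction l with
  | nil => simp
  | cons g l ih =>
    cases g with
    | inl i => rw [word_t, map_mul, ih, parity_t, mul_smul_comm, wordDegree_t]
    | inr i =>
      rw [word_dt, map_mul, ih, parity_dt, mul_smul_comm, wordDegree_dt, Int.negOnePow_succ,
        neg_mul, smul_neg, Units.neg_smul]

theorem dMatrix_t (i : Fin (n + 1)) : dMatrix (t K i) = !![t K i, dt K i; 0, t K i] := by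
  simp [dMatrix]

theorem dMatrix_dt (i : Fin (n + 1)) : dMatrix (dt K i) = !![-dt K i, 0; 0, dt K i] := by
  simp [dMatrix]

theorem dMatrix_word (l : List (Gen n)) :
    dMatrix (word (K := K) l) = !![parity (word l), d (word l); 0, word l] := by
  induction l with
  | nil => ext a b; fin_cases a <;> fin_cases b <;> simp
  | cons g l ih =>
    cases g with
    | inl i =>
      have h : d (t K i * word l) = t K i * d (word l) + dt K i * word l := by
        rw [d, LinearMap.comp_apply, AlgHom.toLinearMap_apply, map_mul, dMatrix_t, ih,
          Matrix.mul_fin_two]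
        rfl
      rw [word_t, h, map_mul, map_mul, dMatrix_t, ih, Matrix.mul_fin_two, parity_t]
      simp
    | inr i =>
      have h : d (dt K i * word l) = -dt K i * d (word l) + 0 * word l := by
        rw [d, LinearMap.comp_apply, AlgHom.toLinearMap_apply, map_mul, dMatrix_dt, ih,
          Matrix.mul_fin_two]
        rfl
      rw [word_dt, h, map_mul, map_mul, dMatrix_dt, ih, Matrix.mul_fin_two, parity_dt]
      simp

theorem d_mul {i : ℤ} {x : Alg K n} (hx : x ∈ forms K n i) {j : ℤ} {y : Alg K n}
    (hy : y ∈ forms K n j) : d (x * y) = d x * y + i.negOnePow • (x * d y) := by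
  have key : ∀ l m : List (Gen n), d (word (K := K) l * word m) =
      d (word l) * word m + (wordDegree l).negOnePow • (word l * d (word m)) := by
    intro l m
    rw [add_comm (d (word l) * word m), d, LinearMap.comp_apply, AlgHom.toLinearMap_apply,
      map_mul, dMatrix_word l, dMatrix_word m, Matrix.mul_fin_two, parity_word, smul_mul_assoc,
      smul_mul_assoc]
    rfl
  refine eqOn_forms (d ∘ₗ LinearMap.mulRight K y)
    (LinearMap.mulRight K y ∘ₗ d + i.negOnePow • LinearMap.mulRight K (d y)) (fun l hl => ?_) hx
  refine eqOn_forms (d ∘ₗ LinearMap.mulLeft K (word l))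
    (LinearMap.mulLeft K (d (word l)) + i.negOnePow • (LinearMap.mulLeft K (word l) ∘ₗ d))
    (fun m hm => ?_) hy
  subst hl
  exact key l m

theorem d_mem {i j : ℤ} (h : i + 1 = j) {x : Alg K n} (hx : x ∈ forms K n i) :
    d x ∈ forms K n j := by
  refine map_mem_forms d (fun l hl => ?_) hx
  subst hl h
  clear hx x
  induction l with
  | nil => simp
  | cons g l ih =>
    cases g with
    | inl i =>
      rw [word_t, wordDegree_t, d_mul (t_mem i) (word_mem l _ rfl), d_t]
      refine add_mem (mul_mem (by ring) (dt_mem i) (word_mem l _ rfl)) ?_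
      simpa using mul_mem (by ring) (t_mem i) ih
    | inr i =>
      rw [word_dt, wordDegree_dt, d_mul (dt_mem i) (word_mem l _ rfl), d_dt, zero_mul, zero_add]
      simpa using mul_mem (by ring) (dt_mem i) ih

theorem d_d {i : ℤ} {x : Alg K n} (hx : x ∈ forms K n i) : d (d x) = 0 := by
  refine eqOn_forms (d ∘ₗ d) 0 (fun l hl => ?_) hx
  clear hx x hl
  induction l with
  | nil => simp
  | cons g l ih =>
    have ih' : d (d (word (K := K) l)) = 0 := ih
    have hd := d_mem (K := K) rfl (word_mem l _ rfl)
    cases g with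
    | inl i =>
      simp [d_mul (t_mem i) (word_mem l _ rfl), d_mul (t_mem i) hd,
        d_mul (dt_mem i) (word_mem l _ rfl), ih']
    | inr i =>
      simp [d_mul (dt_mem i) (word_mem l _ rfl), d_mul (dt_mem i) hd, ih']

theorem mul_comm {i j : ℤ} {x y : Alg K n} (hx : x ∈ forms K n i) (hy : y ∈ forms K n j) :
    x * y = (i * j).negOnePow • (y * x) := by
  have ht : ∀ (a : Fin (n + 1)) (m : List (Gen n)), t K a * word m = word m * t K a := by
    intro a m
    induction m with
    | nil => simp
    | cons g m ih =>
      cases g with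
      | inl b => rw [word_t, ← mul_assoc, (relations K).t_t, mul_assoc, ih, mul_assoc]
      | inr b => rw [word_dt, ← mul_assoc, (relations K).t_dt, mul_assoc, ih, mul_assoc]
  have hdt : ∀ (a : Fin (n + 1)) (m : List (Gen n)),
      dt K a * word m = (wordDegree m).negOnePow • (word m * dt K a) := by
    intro a m
    induction m with
    | nil => simp
    | cons g m ih =>
      cases g with
      | inl b =>
        rw [word_t, ← mul_assoc, ← (relations K).t_dt, mul_assoc, ih, wordDegree_t,
          mul_smul_comm, mul_assoc]
      | inr b =>
        rw [word_dt, ← mul_assoc, (relations K).dt_dt, neg_mul, mul_assoc, ih, wordDegree_dt,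
          mul_smul_comm, mul_assoc, Int.negOnePow_succ, Units.neg_smul]
  have key : ∀ l m : List (Gen n), word (K := K) l * word m =
      (wordDegree l * wordDegree m).negOnePow • (word m * word l) := by
    intro l m
    induction l with
    | nil => simp
    | cons g l ih =>
      cases g with
      | inl a =>
        rw [word_t, mul_assoc, ih, mul_smul_comm, ← mul_assoc, ht, mul_assoc, wordDegree_t]
      | inr a =>
        rw [word_dt, mul_assoc, ih, mul_smul_comm, ← mul_assoc, hdt, smul_mul_assoc, smul_smul,
          ← Int.negOnePow_add, mul_assoc, wordDegree_dt, add_mul, one_mul]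
  refine eqOn_forms (LinearMap.mulRight K y) ((i * j).negOnePow • LinearMap.mulLeft K y)
    (fun l hl => ?_) hx
  refine eqOn_forms (LinearMap.mulLeft K (word l)) ((i * j).negOnePow • LinearMap.mulRight K (word (K := K) l))
    (fun m hm => ?_) hy
  subst hl hm
  exact key l m

/-- The restriction of forms to the `k`-th face: `t_j ↦ t_j` for `j < k`, `t_k ↦ 0`,
`t_j ↦ t_{j-1}` for `j > k`, and likewise for `dt_j`. -/
def face (k : Fin (n + 2)) : Alg K (n + 1) →ₐ[K] Alg K n :=
  lift (k.insertNth (α := fun _ => Alg K n) 0 (t K)) (k.insertNth (α := fun _ => Alg K n) 0 (dt K))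
    { t_t := fun i j => by
        induction i using k.succAboveCases <;> induction j using k.succAboveCases <;>
          simp [(relations K).t_t]
      t_dt := fun i j => by
        induction i using k.succAboveCases <;> induction j using k.succAboveCases <;>
          simp [(relations K).t_dt]
      dt_dt := fun i j => by
        induction i using k.succAboveCases <;> induction j using k.succAboveCases <;>
          simp [← (relations K).dt_dt]
      dt_sq := fun i => by
        induction i using k.succAboveCases <;> simp [(relations K).dt_sq]
      sum_t := by rw [Fin.sum_univ_succAbove _ k]; simp [(relations K).sum_t]
      sum_dt := by rw [Fin.sum_univ_succAbove _ k]; simp [(relations K).sum_dt] }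

theorem face_t_mem (k : Fin (n + 2)) (i : Fin (n + 2)) : face k (t K i) ∈ forms K n 0 := by
  rw [face, lift_t]
  induction i using k.succAboveCases <;> simp [t_mem]

theorem face_dt_mem (k : Fin (n + 2)) (i : Fin (n + 2)) : face k (dt K i) ∈ forms K n 1 := by
  rw [face, lift_dt]
  induction i using k.succAboveCases <;> simp [dt_mem]

theorem face_mem (k : Fin (n + 2)) {i : ℤ} {x : Alg K (n + 1)} (hx : x ∈ forms K (n + 1) i) :
    face k x ∈ forms K n i := by
  refine map_mem_forms (face k).toLinearMap (fun l hl => ?_) hx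
  subst hl
  clear hx x
  induction l with
  | nil => simp [one_mem]
  | cons g l ih =>
    cases g with
    | inl a =>
      rw [word_t, wordDegree_t, AlgHom.toLinearMap_apply, map_mul]
      exact mul_mem (by ring) (face_t_mem k a) ih
    | inr a =>
      rw [word_dt, wordDegree_dt, AlgHom.toLinearMap_apply, map_mul]
      exact mul_mem (by ring) (face_dt_mem k a) ih

theorem face_dt (k i : Fin (n + 2)) : face k (dt K i) = d (face k (t K i)) := by
  rw [face, lift_t, lift_dt]
  induction i using k.succAboveCases <;> simp

theorem face_d (k : Fin (n + 2)) {i : ℤ} {x : Alg K (n + 1)} (hx : x ∈ forms K (n + 1) i) :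
    face k (d x) = d (face k x) := by
  refine eqOn_forms ((face k).toLinearMap ∘ₗ d) (d ∘ₗ (face k).toLinearMap) (fun l hl => ?_) hx
  clear hl hx x
  induction l with
  | nil => simp
  | cons g l ih =>
    have ih' : face k (d (word (K := K) l)) = d (face k (word l)) := ih
    have hl := face_mem (K := K) k (word_mem l _ rfl)
    simp only [LinearMap.comp_apply, AlgHom.toLinearMap_apply]
    cases g with
    | inl a =>
      rw [word_t, d_mul (t_mem a) (word_mem l _ rfl), map_mul, d_mul (face_t_mem k a) hl, d_t,
        ← face_dt, ← ih']
      simp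
    | inr a =>
      have h0 : d (face k (dt K a)) = 0 := by rw [face_dt, d_d (face_t_mem k a)]
      rw [word_dt, d_mul (dt_mem a) (word_mem l _ rfl), map_mul, d_mul (face_dt_mem k a) hl, d_dt,
        h0, ← ih']
      simp

end

end SimplexForms

/-- The polynomial de Rham algebra `Ωₙ` of the standard `n`-simplex. -/
def Omega (K : Type u) [Field K] (n : ℕ) : CDGA.{u, u} K where
  V i := SimplexForms.forms K n i
  d i j h := SimplexForms.d.restrict fun _ hx => SimplexForms.d_mem h hx
  one := ⟨1, SimplexForms.one_mem⟩
  mul i j k h := LinearMap.mk₂ K (fun x y => ⟨x.1 * y.1, SimplexForms.mul_mem h x.2 y.2⟩)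
    (fun x x' y => Subtype.ext (add_mul x.1 x'.1 y.1))
    (fun c x y => Subtype.ext (smul_mul_assoc c x.1 y.1))
    (fun x y y' => Subtype.ext (mul_add x.1 y.1 y'.1))
    (fun c x y => Subtype.ext (mul_smul_comm c x.1 y.1))
  d_d _ _ _ _ _ x := Subtype.ext (SimplexForms.d_d x.2)
  one_mul _ _ x := Subtype.ext (one_mul x.1)
  mul_assoc _ _ _ _ _ _ _ _ _ _ x y z := Subtype.ext (mul_assoc x.1 y.1 z.1)
  mul_comm _ _ _ _ _ x y := Subtype.ext <| by
    simpa [Units.smul_def] using SimplexForms.mul_comm x.2 y.2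
  leibniz _ _ _ _ _ _ _ _ _ _ _ _ x y := Subtype.ext <| by
    simpa [Units.smul_def] using SimplexForms.d_mul x.2 y.2

/-- The morphism `∂ₖ* : Ωₙ₊₁ → Ωₙ`. -/
def Omega.face {K : Type u} [Field K] {n : ℕ} (k : Fin (n + 2)) :
    CDGA.Hom (Omega K (n + 1)) (Omega K n) where
  f _ := (SimplexForms.face k).toLinearMap.restrict fun _ hx => SimplexForms.face_mem k hx
  map_d _ _ _ x := Subtype.ext (SimplexForms.face_d k x.2)
  map_one := Subtype.ext (map_one (SimplexForms.face k))
  map_mul _ _ _ _ x y := Subtype.ext (map_mul (SimplexForms.face k) x.1 y.1)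

/-! ## Semicosimplicial DGLAs and their totalization -/

/-- A semicosimplicial DGLA: DGLAs `Lₙ`, `n ≥ 0`, and face operators `∂ₖ : Lₙ → Lₙ₊₁`,
`0 ≤ k ≤ n + 1`, such that `∂ₗ ∂ₖ = ∂ₖ₊₁ ∂ₗ` for `l ≤ k`. -/
structure SemicosimplicialDGLA (K : Type u) [Field K] where
  /-- The DGLA `Lₙ`. -/
  obj : ℕ → DGLA.{u, v} K
  /-- The face operators `∂ₖ : Lₙ → Lₙ₊₁`. -/
  face : ∀ n : ℕ, Fin (n + 2) → DGLA.Hom (obj n) (obj (n + 1))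
  face_face : ∀ (n : ℕ) (l k : Fin (n + 2)), l ≤ k → ∀ (i : ℤ) (a : (obj n).V i),
    (face (n + 1) l.castSucc).f i ((face n k).f i a) =
      (face (n + 1) k.succ).f i ((face n l).f i a)

namespace SemicosimplicialDGLA

/-- The component of degree `p` of the Thom–Whitney totalization: the sequences
`(xₙ) ∈ ∏ₙ (Ωₙ ⊗ Lₙ)ᵖ` such that `(∂ₖ* ⊗ Id) xₙ₊₁ = (Id ⊗ ∂ₖ) xₙ` in `Ωₙ ⊗ Lₙ₊₁`, for all `n` and
all `0 ≤ k ≤ n + 1`. -/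
def totV {K : Type u} [Field K] (L : SemicosimplicialDGLA.{u, v} K) (p : ℤ) :
    Submodule K (∀ n : ℕ, (DGLA.tensor (Omega K n) (L.obj n)).V p) where
  carrier := {x | ∀ (n : ℕ) (k : Fin (n + 2)),
    (DGLA.Hom.tensor (Omega.face k) (DGLA.Hom.id (L.obj (n + 1)))).f p (x (n + 1)) =
      (DGLA.Hom.tensor (CDGA.Hom.id (Omega K n)) (L.face n k)).f p (x n)}
  add_mem' hx hy n k := by
    rw [Pi.add_apply, Pi.add_apply, map_add, map_add, hx n k, hy n k]
  zero_mem' n k := by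
    rw [Pi.zero_apply, Pi.zero_apply, map_zero, map_zero]
  smul_mem' c x hx n k := by
    rw [Pi.smul_apply, Pi.smul_apply, map_smul, map_smul, hx n k]

/-- The Thom–Whitney totalization of a semicosimplicial DGLA, with the differential and the bracket
of the product `∏ₙ Ωₙ ⊗ Lₙ`. -/
def Tot {K : Type u} [Field K] (L : SemicosimplicialDGLA.{u, v} K) : DGLA.{u, max u v} K where
  V p := L.totV p
  d p q h :=
    { toFun := fun x => ⟨fun n => (DGLA.tensor (Omega K n) (L.obj n)).d p q h (x.1 n),
        fun n k => by rw [DGLA.Hom.map_d, DGLA.Hom.map_d, x.2 n k]⟩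
      map_add' := fun x y => Subtype.ext <| funext fun n =>
        map_add ((DGLA.tensor (Omega K n) (L.obj n)).d p q h) (x.1 n) (y.1 n)
      map_smul' := fun c x => Subtype.ext <| funext fun n =>
        map_smul ((DGLA.tensor (Omega K n) (L.obj n)).d p q h) c (x.1 n) }
  br p q r h := LinearMap.mk₂ K
    (fun x y => ⟨fun n => (DGLA.tensor (Omega K n) (L.obj n)).br p q r h (x.1 n) (y.1 n),
      fun n k => by rw [DGLA.Hom.map_br, DGLA.Hom.map_br, x.2 n k, y.2 n k]⟩)
    (fun x x' y => Subtype.ext <| funext fun n =>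
      LinearMap.map_add₂ ((DGLA.tensor (Omega K n) (L.obj n)).br p q r h) (x.1 n) (x'.1 n) (y.1 n))
    (fun c x y => Subtype.ext <| funext fun n =>
      LinearMap.map_smul₂ ((DGLA.tensor (Omega K n) (L.obj n)).br p q r h) c (x.1 n) (y.1 n))
    (fun x y y' => Subtype.ext <| funext fun n =>
      map_add ((DGLA.tensor (Omega K n) (L.obj n)).br p q r h (x.1 n)) (y.1 n) (y'.1 n))
    (fun c x y => Subtype.ext <| funext fun n =>
      map_smul ((DGLA.tensor (Omega K n) (L.obj n)).br p q r h (x.1 n)) c (y.1 n))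
  d_d p q r h h' x := Subtype.ext <| funext fun n =>
    (DGLA.tensor (Omega K n) (L.obj n)).d_d p q r h h' (x.1 n)
  skew p q r h h' x y := Subtype.ext <| funext fun n =>
    (DGLA.tensor (Omega K n) (L.obj n)).skew p q r h h' (x.1 n) (y.1 n)
  jacobi p q r pq qr pr s hpq hqr hpr h₁ h₂ h₃ x y z := Subtype.ext <| funext fun n =>
    (DGLA.tensor (Omega K n) (L.obj n)).jacobi p q r pq qr pr s hpq hqr hpr h₁ h₂ h₃
      (x.1 n) (y.1 n) (z.1 n)
  leibniz p q r p' q' r' h hp hq hr h₁ h₂ x y := Subtype.ext <| funext fun n =>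
    (DGLA.tensor (Omega K n) (L.obj n)).leibniz p q r p' q' r' h hp hq hr h₁ h₂ (x.1 n) (y.1 n)

end SemicosimplicialDGLA

end

/-!
If `h` is a primitive of the bracket of a DGLA `N`, that is `[·,·] = [d, h]`, and `h` commutes with
the bracket, then the exponential of `h` is an `L∞`-isomorphism from `N` to the complex `N` with
the zero bracket. It is the solution of a linear differential equation, which can be written down
as a DGLA over the polynomial forms on the line: on `N[s] ⊕ ds N[s]`, take the differential
`d + ds ∂ₛ` and the bracket `s [·,·] + ds h` (`IsBracketPrimitive.path`). The Leibniz rule is the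
equation `[·,·] = [d, h]`, and the Jacobi identity is the Jacobi identity of `N` together with the
vanishing of the commutator of `h` and the bracket. The evaluation at `s = 1` is a morphism to `N`,
and the evaluation at `s = 0` is a morphism to `N` with the zero bracket. In characteristic zero
polynomials can be integrated, so both are quasi-isomorphisms, and `N` is homotopy abelian
(`IsBracketPrimitive.isHomotopyAbelian`).

This applies to the totalization: the maps `hₙ` extend to `Ωₙ ⊗ Lₙ` by multiplication of forms
(`IsBracketPrimitive.tensor`), and compatibility with the face operators makes the extensions
a bilinear map on the totalization, where the conditions hold because they hold in each component
(`isBracketPrimitive_totPrimitive`).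

The construction of the path is split in two. `scaledPoly` is the DGLA `N[s]` with bracket
`s [·,·]`, for which `∂ₛ` is a derivation up to `[·,·]`, that is up to the boundary of `h`;
`twistedPath` adds the summand with `ds` for any such derivation up to a boundary.
-/

noncomputable section

/-! ### Primitives of the bracket -/

namespace DGLA

/-- A bilinear map `h` of degree `-1` that is a primitive of the bracket for the differential on
bilinear maps, and whose commutator with the bracket vanishes. The last condition is the cyclic one
of `IsAbelianityHomotopy`, rewritten by skew symmetry in the shape of the Jacobi identity: it says
that `[·,·] + ε h`, with `ε` of degree `1` and `ε² = 0`, still satisfies the Jacobi identity.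
Degrees are arguments, so that the equations can be used without casts. -/
structure IsBracketPrimitive {K : Type u} [Field K] (L : DGLA.{u, v} K)
    (h : L.BilinNegOne) : Prop where
  skew : ∀ (i j k : ℤ) (hij : i + j - 1 = k) (hji : j + i - 1 = k) (a : L.V i) (b : L.V j),
    h i j k hij a b = -((i * j).negOnePow • h j i k hji b a)
  bracket : ∀ (i j k i' j' m : ℤ) (hij : i + j = k) (hi : i + 1 = i') (hj : j + 1 = j')
    (hm : m + 1 = k) (h₁ : i + j - 1 = m) (h₂ : i' + j - 1 = k) (h₃ : i + j' - 1 = k)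
    (a : L.V i) (b : L.V j),
    L.br i j k hij a b = L.d m k hm (h i j m h₁ a b) + h i' j k h₂ (L.d i i' hi a) b
      + i.negOnePow • h i j' k h₃ a (L.d j j' hj b)
  jacobi : ∀ (i j k ij jk ik ij' jk' ik' s : ℤ) (hij : i + j = ij) (hjk : j + k = jk)
    (hik : i + k = ik) (hij' : i + j - 1 = ij') (hjk' : j + k - 1 = jk') (hik' : i + k - 1 = ik')
    (h₁ : i + jk - 1 = s) (h₂ : ij + k - 1 = s) (h₃ : j + ik - 1 = s)
    (h₁' : i + jk' = s) (h₂' : ij' + k = s) (h₃' : j + ik' = s)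
    (a : L.V i) (b : L.V j) (c : L.V k),
    h i jk s h₁ a (L.br j k jk hjk b c)
        + i.negOnePow • L.br i jk' s h₁' a (h j k jk' hjk' b c) =
      h ij k s h₂ (L.br i j ij hij a b) c + L.br ij' k s h₂' (h i j ij' hij' a b) c
        + (i * j).negOnePow • (h j ik s h₃ b (L.br i k ik hik a c)
          + j.negOnePow • L.br j ik' s h₃' b (h i k ik' hik' a c))

theorem IsAbelianityHomotopy.isBracketPrimitive {K : Type u} [Field K] {L : DGLA.{u, v} K}
    {h : L.BilinNegOne} (hL : L.IsAbelianityHomotopy h) : L.IsBracketPrimitive h where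
  skew i j k hij _ := hL.skew i j k hij
  bracket i j k i' j' m hij hi hj hm h₁ h₂ h₃ a b := by
    obtain rfl : m = k - 1 := by omega
    subst hi hj
    exact hL.bracket i j k hij a b
  jacobi i j k ij jk ik ij' jk' ik' s hij hjk hik hij' hjk' hik' h₁ h₂ h₃ h₁' h₂' h₃' a b c := by
    have key := hL.cyclic i j k s (by omega) a b c
    obtain rfl : ik = k + i := by omega
    obtain rfl : ik' = k + i - 1 := by omega
    subst hij hjk hij' hjk'
    have e₁ : (i * (j + k)).negOnePow • L.br (j + k - 1) i s (by omega) (h j k _ rfl b c) a =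
        -(i.negOnePow • L.br i (j + k - 1) s h₁' a (h j k _ rfl b c)) := by
      rw [L.skew (j + k - 1) i s _ h₁', smul_neg, smul_smul, ← Int.negOnePow_add]
      congr 2
      rw [Int.negOnePow_eq_iff]
      exact ⟨i * (j + k) - i, by ring⟩
    have e₂ : (k * (i + j)).negOnePow • L.br (k + i - 1) j s (by omega) (h k i _ rfl c a) b =
        (i * j).negOnePow • j.negOnePow • L.br j (k + i - 1) s h₃' b (h i k _ hik' a c) := by
      rw [L.skew (k + i - 1) j s _ h₃', hL.skew k i, map_neg, CDGATensor.map_sign]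
      simp only [smul_neg, neg_neg, smul_smul, ← Int.negOnePow_add]
      congr 1
      rw [Int.negOnePow_eq_iff]
      exact ⟨k * i + k * j - j, by ring⟩
    have e₃ : (i * (j + k)).negOnePow • h (j + k) i s (by omega) (L.br j k _ rfl b c) a =
        -h i (j + k) s h₁ a (L.br j k _ rfl b c) := by
      rw [hL.skew (j + k) i, smul_neg, smul_smul, mul_comm i, Int.units_mul_self, one_smul]
    have e₄ : (k * (i + j)).negOnePow • h (k + i) j s (by omega) (L.br k i _ rfl c a) b =
        (i * j).negOnePow • h j (k + i) s h₃ b (L.br i k _ hik a c) := by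
      rw [hL.skew (k + i) j, L.skew k i _ _ hik, map_neg, CDGATensor.map_sign]
      simp only [smul_neg, neg_neg, smul_smul, ← Int.negOnePow_add]
      congr 1
      rw [Int.negOnePow_eq_iff]
      exact ⟨k * i + k * j, by ring⟩
    rw [e₁, e₂, e₃, e₄] at key
    rw [smul_add, ← sub_eq_zero, ← neg_eq_zero, ← key]
    abel

/-! ### The path object twisted by a primitive -/

/-- The conditions on a linear map `δ` of degree `0` and a bilinear map `η` of degree `-1` under
which `d + ds δ` and `[·,·] + ds η` make `N ⊕ ds N` a DGLA: the map `δ` commutes with the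
differential, its failure to be a derivation of the bracket is the boundary of `η`, and the
commutator of `η` with the bracket vanishes. The map `δ` has a source and a target degree, with
a proof that they are equal. -/
structure IsTwist {K : Type u} [Field K] (N : DGLA.{u, v} K)
    (δ : ∀ i j : ℤ, i = j → (N.V i →ₗ[K] N.V j)) (η : N.BilinNegOne) : Prop where
  map_d : ∀ (i j i' j' : ℤ) (h : i + 1 = j) (h' : i' + 1 = j') (hi : i = i') (hj : j = j')
    (a : N.V i), δ j j' hj (N.d i j h a) = N.d i' j' h' (δ i i' hi a)
  skew : ∀ (i j k : ℤ) (hij : i + j - 1 = k) (hji : j + i - 1 = k) (a : N.V i) (b : N.V j),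
    η i j k hij a b = -((i * j).negOnePow • η j i k hji b a)
  map_br : ∀ (i j k i' j' k' m i₁ j₁ : ℤ) (hij : i + j = k) (hi : i + 1 = i') (hj : j + 1 = j')
    (hk : k = k') (hm : m + 1 = k') (h₁ : i + j - 1 = m) (h₂ : i' + j - 1 = k')
    (h₃ : i + j' - 1 = k') (hi₁ : i = i₁) (hj₁ : j = j₁) (h₄ : i₁ + j = k') (h₅ : i + j₁ = k')
    (a : N.V i) (b : N.V j),
    δ k k' hk (N.br i j k hij a b) =
      N.br i₁ j k' h₄ (δ i i₁ hi₁ a) b + N.br i j₁ k' h₅ a (δ j j₁ hj₁ b)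
        + (N.d m k' hm (η i j m h₁ a b) + η i' j k' h₂ (N.d i i' hi a) b
          + i.negOnePow • η i j' k' h₃ a (N.d j j' hj b))
  jacobi : ∀ (i j k ij jk ik ij' jk' ik' s : ℤ) (hij : i + j = ij) (hjk : j + k = jk)
    (hik : i + k = ik) (hij' : i + j - 1 = ij') (hjk' : j + k - 1 = jk') (hik' : i + k - 1 = ik')
    (h₁ : i + jk - 1 = s) (h₂ : ij + k - 1 = s) (h₃ : j + ik - 1 = s)
    (h₁' : i + jk' = s) (h₂' : ij' + k = s) (h₃' : j + ik' = s)
    (a : N.V i) (b : N.V j) (c : N.V k),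
    η i jk s h₁ a (N.br j k jk hjk b c)
        + i.negOnePow • N.br i jk' s h₁' a (η j k jk' hjk' b c) =
      η ij k s h₂ (N.br i j ij hij a b) c + N.br ij' k s h₂' (η i j ij' hij' a b) c
        + (i * j).negOnePow • (η j ik s h₃ b (N.br i k ik hik a c)
          + j.negOnePow • N.br j ik' s h₃' b (η i k ik' hik' a c))

/-- The DGLA `N ⊕ ds N` with the differential `d + ds δ` and the bracket `[·,·] + ds η`. The pair
`(x, y)` stands for `x + ds y`. -/
def twistedPath {K : Type u} [Field K] (N : DGLA.{u, v} K)
    (δ : ∀ i j : ℤ, i = j → (N.V i →ₗ[K] N.V j)) (η : N.BilinNegOne) (H : N.IsTwist δ η) :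
    DGLA.{u, v} K where
  V i := N.V i × N.V (i - 1)
  d i j h := LinearMap.prod (N.d i j h ∘ₗ LinearMap.fst K _ _)
    (δ i (j - 1) (by omega) ∘ₗ LinearMap.fst K _ _
      - N.d (i - 1) (j - 1) (by omega) ∘ₗ LinearMap.snd K _ _)
  br i j k h := LinearMap.mk₂ K
    (fun x y => (N.br i j k h x.1 y.1,
      η i j (k - 1) (by omega) x.1 y.1 + N.br (i - 1) j (k - 1) (by omega) x.2 y.1
        + i.negOnePow • N.br i (j - 1) (k - 1) (by omega) x.1 y.2))
    (fun x x' y => by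
      ext
      · simp
      · simp only [Prod.fst_add, Prod.snd_add, map_add, LinearMap.add_apply, smul_add]; abel)
    (fun c x y => by
      ext
      · simp
      · simp [Units.smul_def, smul_add, smul_comm c])
    (fun x y y' => by
      ext
      · simp
      · simp only [Prod.fst_add, Prod.snd_add, map_add, smul_add]; abel)
    (fun c x y => by
      ext
      · simp
      · simp [Units.smul_def, smul_add, smul_comm c])
  d_d i j k hij hjk a := by
    ext
    · exact N.d_d i j k hij hjk a.1
    · have h₁ := H.map_d i j (j - 1) (k - 1) hij (by omega) (by omega) (by omega) a.1
      have h₂ := N.d_d (i - 1) (j - 1) (k - 1) (by omega) (by omega) a.2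
      simp [h₁, h₂]
  skew i j k hij hji a b := by
    ext
    · exact N.skew i j k hij hji a.1 b.1
    · simp only [LinearMap.mk₂_apply, Prod.snd_neg, Prod.smul_snd]
      rw [H.skew i j (k - 1) _ (by omega) a.1 b.1, N.skew (i - 1) j (k - 1) _ (by omega) a.2 b.1,
        N.skew i (j - 1) (k - 1) _ (by omega) a.1 b.2]
      simp only [smul_add, smul_neg, smul_smul, ← Int.negOnePow_add]
      have e₁ : ((i - 1) * j).negOnePow = (i * j + j).negOnePow := by
        rw [Int.negOnePow_eq_iff]; exact ⟨-j, by ring⟩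
      have e₂ : (i + i * (j - 1)).negOnePow = (i * j).negOnePow := by
        congr 1; ring
      rw [e₁, e₂]
      abel
  leibniz i j k i' j' k' hij hi hj hk h₁ h₂ a b := by
    ext
    · exact N.leibniz i j k i' j' k' hij hi hj hk h₁ h₂ a.1 b.1
    · simp only [LinearMap.mk₂_apply, LinearMap.prod_apply, Function.prod_apply,
        LinearMap.comp_apply, LinearMap.fst_apply, LinearMap.snd_apply, LinearMap.sub_apply, map_add,
        Prod.snd_add,
        Prod.smul_snd, CDGATensor.map_sign, map_sub, LinearMap.sub_apply]
      rw [H.map_br i j k i' j' (k' - 1) (k - 1) (i' - 1) (j' - 1) hij hi hj (by omega) (by omega)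
        (by omega) (by omega) (by omega) (by omega) (by omega) (by omega) (by omega) a.1 b.1,
        N.leibniz (i - 1) j (k - 1) (i' - 1) j' (k' - 1) (by omega) (by omega) hj (by omega)
          (by omega) (by omega) a.2 b.1,
        N.leibniz i (j - 1) (k - 1) i' (j' - 1) (k' - 1) (by omega) hi (by omega) (by omega)
          (by omega) (by omega) a.1 b.2]
      subst hi
      simp only [smul_add, smul_sub, smul_smul, Int.negOnePow_sub, Int.negOnePow_one,
        Units.neg_smul, mul_neg, mul_one, Int.units_mul_self, Int.negOnePow_add, one_smul]
      abel
  jacobi i j k ij jk ik s hij hjk hik h₁ h₂ h₃ a b c := by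
    ext
    · exact N.jacobi i j k ij jk ik s hij hjk hik h₁ h₂ h₃ a.1 b.1 c.1
    · simp only [LinearMap.mk₂_apply, map_add, Prod.snd_add, Prod.smul_snd, CDGATensor.map_sign,
        LinearMap.add_apply, LinearMap.smul_apply]
      have e := H.jacobi i j k ij jk ik (ij - 1) (jk - 1) (ik - 1) (s - 1) hij hjk hik (by omega)
        (by omega) (by omega) (by omega) (by omega) (by omega) (by omega) (by omega) (by omega)
        a.1 b.1 c.1
      have e₁ := N.jacobi (i - 1) j k (ij - 1) jk (ik - 1) (s - 1) (by omega) hjk (by omega)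
        (by omega) (by omega) (by omega) a.2 b.1 c.1
      have e₂ := N.jacobi i (j - 1) k (ij - 1) (jk - 1) ik (s - 1) (by omega) (by omega) hik
        (by omega) (by omega) (by omega) a.1 b.2 c.1
      have e₃ := N.jacobi i j (k - 1) ij (jk - 1) (ik - 1) (s - 1) hij (by omega) (by omega)
        (by omega) (by omega) (by omega) a.1 b.1 c.2
      rw [smul_add, smul_add, add_assoc (i.negOnePow • _), add_add_add_comm, e, e₁, e₂, e₃]
      subst hij hjk hik
      have s₁ : ((i - 1) * j).negOnePow = (i * j + j).negOnePow := by
        rw [Int.negOnePow_eq_iff]; exact ⟨-j, by ring⟩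
      have s₂ : (i * (j - 1)).negOnePow = (i * j - i).negOnePow := by
        congr 1; ring
      rw [s₁, s₂]
      simp only [smul_add, smul_smul, ← Int.negOnePow_add]
      have s₃ : (i + (i * j - i)).negOnePow = (i * j).negOnePow := by
        congr 1; ring
      rw [s₃]
      abel_nf

/-! ### Polynomials with coefficients in a DGLA -/

section Polynomials

variable {K : Type u} [Field K] {A B C : Type*} [AddCommGroup A] [AddCommGroup B]
  [AddCommGroup C] [Module K A] [Module K B] [Module K C]

/-- The bilinear map `(f, g) ↦ s^e F(f, g)` on polynomials in `s`, for a bilinear map `F` on the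
coefficients. The finitely supported function `f` stands for `∑ s^m f(m)`. -/
def polyMap₂ (e : ℕ) (F : A →ₗ[K] B →ₗ[K] C) : (ℕ →₀ A) →ₗ[K] (ℕ →₀ B) →ₗ[K] (ℕ →₀ C) :=
  Finsupp.lsum K fun m => LinearMap.flip <| Finsupp.lsum K fun n => LinearMap.flip <|
    F.compr₂ (Finsupp.lsingle (m + n + e))

@[simp]
theorem polyMap₂_single (e : ℕ) (F : A →ₗ[K] B →ₗ[K] C) (m n : ℕ) (a : A) (b : B) :
    polyMap₂ e F (Finsupp.single m a) (Finsupp.single n b) =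
      Finsupp.single (m + n + e) (F a b) := by
  simp [polyMap₂]

/-- The derivative with respect to `s`. For `m = 0` the coefficient vanishes, so that the truncated
exponent `m - 1` does not matter. -/
def polyDeriv (K : Type u) [Field K] (A : Type*) [AddCommGroup A] [Module K A] :
    (ℕ →₀ A) →ₗ[K] (ℕ →₀ A) :=
  Finsupp.lsum K fun m => (m : K) • Finsupp.lsingle (m - 1)

@[simp]
theorem polyDeriv_single (m : ℕ) (a : A) :
    polyDeriv K A (Finsupp.single m a) = Finsupp.single (m - 1) ((m : K) • a) := by
  simp [polyDeriv]

/-- The evaluation at `s = c`. -/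
def polyEval (A : Type*) [AddCommGroup A] [Module K A] (c : K) : (ℕ →₀ A) →ₗ[K] A :=
  Finsupp.lsum K fun m => c ^ m • LinearMap.id

@[simp]
theorem polyEval_single (c : K) (m : ℕ) (a : A) :
    polyEval A c (Finsupp.single m a) = c ^ m • a := by
  simp [polyEval]

theorem polyEval_polyMap₂ (c : K) (e : ℕ) (F : A →ₗ[K] B →ₗ[K] C) (f : ℕ →₀ A) (g : ℕ →₀ B) :
    polyEval C c (polyMap₂ e F f g) = c ^ e • F (polyEval A c f) (polyEval B c g) := by
  induction f using Finsupp.induction_linear with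
  | zero => simp
  | add f f' hf hf' => simp only [map_add, LinearMap.add_apply, smul_add, hf, hf']
  | single m a =>
    induction g using Finsupp.induction_linear with
    | zero => simp
    | add g g' hg hg' => simp only [map_add, smul_add, hg, hg']
    | single n b =>
      simp only [polyMap₂_single, polyEval_single, map_smul, LinearMap.smul_apply, smul_smul]
      congr 1
      ring

/-- The primitive that vanishes at `s = c`. -/
def polyInt (A : Type*) [AddCommGroup A] [Module K A] (c : K) : (ℕ →₀ A) →ₗ[K] (ℕ →₀ A) :=
  Finsupp.lsum K fun m => (m + 1 : K)⁻¹ • (Finsupp.lsingle (m + 1) - c ^ (m + 1) •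
    Finsupp.lsingle 0)

@[simp]
theorem polyInt_single (c : K) (m : ℕ) (a : A) :
    polyInt A c (Finsupp.single m a) =
      (m + 1 : K)⁻¹ • (Finsupp.single (m + 1) a - c ^ (m + 1) • Finsupp.single 0 a) := by
  simp [polyInt]

theorem polyDeriv_polyInt [CharZero K] (c : K) (f : ℕ →₀ A) :
    polyDeriv K A (polyInt A c f) = f := by
  induction f using Finsupp.induction_linear with
  | zero => simp
  | add f f' hf hf' => simp only [map_add, hf, hf']
  | single m a =>
    have hm : (m + 1 : K) ≠ 0 := Nat.cast_add_one_ne_zero m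
    simp only [polyInt_single, map_smul, map_sub, polyDeriv_single]
    simp [smul_smul, hm]

theorem polyInt_polyDeriv [CharZero K] (c : K) (f : ℕ →₀ A) :
    polyInt A c (polyDeriv K A f) = f - Finsupp.single 0 (polyEval A c f) := by
  induction f using Finsupp.induction_linear with
  | zero => simp
  | add f f' hf hf' => simp only [map_add, hf, hf', Finsupp.single_add]; abel
  | single m a =>
    cases m with
    | zero => simp
    | succ m =>
      have hm : (m + 1 : K) ≠ 0 := Nat.cast_add_one_ne_zero m
      have e : (m + 1 : K)⁻¹ * (c ^ (m + 1) * (m + 1)) = c ^ (m + 1) := by field_simp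
      simp [smul_smul, smul_sub, hm, e]

theorem polyDeriv_mapRange (F : A →ₗ[K] B) (f : ℕ →₀ A) :
    polyDeriv K B (Finsupp.mapRange.linearMap F f) =
      Finsupp.mapRange.linearMap F (polyDeriv K A f) := by
  induction f using Finsupp.induction_linear with
  | zero => simp
  | add f f' hf hf' => simp only [map_add, hf, hf']
  | single m a => simp

theorem polyEval_mapRange (c : K) (F : A →ₗ[K] B) (f : ℕ →₀ A) :
    polyEval B c (Finsupp.mapRange.linearMap F f) = F (polyEval A c f) := by
  induction f using Finsupp.induction_linear with
  | zero => simp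
  | add f f' hf hf' => simp only [map_add, hf, hf']
  | single m a => simp

theorem polyInt_mapRange (c : K) (F : A →ₗ[K] B) (f : ℕ →₀ A) :
    polyInt B c (Finsupp.mapRange.linearMap F f) =
      Finsupp.mapRange.linearMap F (polyInt A c f) := by
  induction f using Finsupp.induction_linear with
  | zero => simp
  | add f f' hf hf' => simp only [map_add, hf, hf']
  | single m a =>
    simp only [polyInt_single, map_smul, map_sub, Finsupp.mapRange.linearMap_apply,
      Finsupp.mapRange_single]

/-- Multiplication of one polynomial by `s` costs the derivative an additional term. -/
theorem polyDeriv_polyMap₂_one (F : A →ₗ[K] B →ₗ[K] C) (f : ℕ →₀ A) (g : ℕ →₀ B) :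
    polyDeriv K C (polyMap₂ 1 F f g) = polyMap₂ 1 F (polyDeriv K A f) g
      + polyMap₂ 1 F f (polyDeriv K B g) + polyMap₂ 0 F f g := by
  induction f using Finsupp.induction_linear with
  | zero => simp
  | add f f' hf hf' => simp only [map_add, LinearMap.add_apply, hf, hf']; abel
  | single m a =>
    induction g using Finsupp.induction_linear with
    | zero => simp
    | add g g' hg hg' => simp only [map_add, hg, hg']; abel
    | single n b =>
      have e₁ : Finsupp.single (m - 1 + n + 1) ((m : K) • F a b) =
          Finsupp.single (m + n) ((m : K) • F a b) := by
        cases m with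
        | zero => simp
        | succ m => congr 1; omega
      have e₂ : Finsupp.single (m + (n - 1) + 1) ((n : K) • F a b) =
          Finsupp.single (m + n) ((n : K) • F a b) := by
        cases n with
        | zero => simp
        | succ n => congr 1
      simp only [polyMap₂_single, polyDeriv_single, map_smul, LinearMap.smul_apply, e₁, e₂,
        ← Finsupp.single_add, ← add_smul]
      simp [add_smul]

theorem polyMap₂_skew (e : ℕ) (F : A →ₗ[K] B →ₗ[K] C) (G : B →ₗ[K] A →ₗ[K] C) (u : ℤˣ)
    (H : ∀ a b, F a b = -(u • G b a)) (f : ℕ →₀ A) (g : ℕ →₀ B) :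
    polyMap₂ e F f g = -(u • polyMap₂ e G g f) := by
  induction f using Finsupp.induction_linear with
  | zero => simp
  | add f f' hf hf' => simp only [map_add, LinearMap.add_apply, hf, hf', smul_add, neg_add]
  | single m a =>
    induction g using Finsupp.induction_linear with
    | zero => simp
    | add g g' hg hg' => simp only [map_add, LinearMap.add_apply, hg, hg', smul_add, neg_add]
    | single n b =>
      rw [polyMap₂_single, polyMap₂_single, H, Finsupp.single_neg, ← Finsupp.smul_single,
        add_comm m n]

/-- If `F` is the boundary of `H` on the coefficients, then it is so on polynomials: the shape of
the equation `[a,b] = d h(a,b) + h(da,b) ± h(a,db)`. -/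
theorem polyMap₂_boundary {A' B' C' : Type*} [AddCommGroup A'] [AddCommGroup B']
    [AddCommGroup C'] [Module K A'] [Module K B'] [Module K C'] (e : ℕ)
    (F : A →ₗ[K] B →ₗ[K] C) (H : A →ₗ[K] B →ₗ[K] C') (H₁ : A' →ₗ[K] B →ₗ[K] C)
    (H₂ : A →ₗ[K] B' →ₗ[K] C) (D : C' →ₗ[K] C) (D₁ : A →ₗ[K] A') (D₂ : B →ₗ[K] B') (u : ℤˣ)
    (hF : ∀ a b, F a b = D (H a b) + H₁ (D₁ a) b + u • H₂ a (D₂ b)) (f : ℕ →₀ A) (g : ℕ →₀ B) :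
    polyMap₂ e F f g = Finsupp.mapRange.linearMap D (polyMap₂ e H f g)
      + polyMap₂ e H₁ (Finsupp.mapRange.linearMap D₁ f) g
      + u • polyMap₂ e H₂ f (Finsupp.mapRange.linearMap D₂ g) := by
  induction f using Finsupp.induction_linear with
  | zero => simp
  | add f f' hf hf' => simp only [map_add, LinearMap.add_apply, hf, hf', smul_add]; abel
  | single m a =>
    induction g using Finsupp.induction_linear with
    | zero => simp
    | add g g' hg hg' => simp only [map_add, hg, hg', smul_add]; abel
    | single n b =>
      simp only [polyMap₂_single, Finsupp.mapRange.linearMap_apply, Finsupp.mapRange_single]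
      rw [hF, Finsupp.single_add, Finsupp.single_add, Finsupp.smul_single]

end Polynomials

/-- The DGLA `N[s]` with the coefficientwise differential and `s` times the bracket of `N`. -/
def scaledPoly {K : Type u} [Field K] (N : DGLA.{u, v} K) : DGLA.{u, v} K where
  V i := ℕ →₀ N.V i
  d i j h := Finsupp.mapRange.linearMap (N.d i j h)
  br i j k h := polyMap₂ 1 (N.br i j k h)
  d_d i j k hij hjk a := by
    induction a using Finsupp.induction_linear with
    | zero => simp
    | add f f' hf hf' => simp only [map_add, hf, hf', add_zero]
    | single m a => simp [N.d_d]
  skew i j k hij hji := polyMap₂_skew 1 _ _ _ (N.skew i j k hij hji)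
  jacobi i j k ij jk ik s hij hjk hik h₁ h₂ h₃ a b c := by
    induction a using Finsupp.induction_linear with
    | zero => simp
    | add f f' hf hf' => simp only [map_add, LinearMap.add_apply, hf, hf', smul_add]; abel
    | single l a =>
    induction b using Finsupp.induction_linear with
    | zero => simp
    | add f f' hf hf' => simp only [map_add, LinearMap.add_apply, hf, hf', smul_add]; abel
    | single m b =>
    induction c using Finsupp.induction_linear with
    | zero => simp
    | add f f' hf hf' => simp only [map_add, hf, hf', smul_add]; abel
    | single n c =>
      simp only [polyMap₂_single]
      rw [N.jacobi i j k ij jk ik s hij hjk hik h₁ h₂ h₃, Finsupp.single_add, Finsupp.smul_single]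
      congr 2 <;> omega
  leibniz i j k i' j' k' hij hi hj hk h₁ h₂ a b := by
    induction a using Finsupp.induction_linear with
    | zero => simp
    | add f f' hf hf' => simp only [map_add, LinearMap.add_apply, hf, hf', smul_add]; abel
    | single m a =>
      induction b using Finsupp.induction_linear with
      | zero => simp
      | add g g' hg hg' => simp only [map_add, hg, hg', smul_add]; abel
      | single n b =>
        simp only [polyMap₂_single, Finsupp.mapRange.linearMap_apply, Finsupp.mapRange_single]
        rw [N.leibniz i j k i' j' k' hij hi hj hk h₁ h₂, Finsupp.single_add, Finsupp.smul_single]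

/-- On `N[s]` with the bracket `s [·,·]`, the derivative `∂ₛ` is a derivation up to `[·,·]`, which
is the boundary of `h`. -/
theorem IsBracketPrimitive.isTwist {K : Type u} [Field K] {N : DGLA.{u, v} K}
    {h : N.BilinNegOne} (hN : N.IsBracketPrimitive h) :
    N.scaledPoly.IsTwist (fun i _ hij => hij ▸ polyDeriv K (N.V i))
      (fun i j k hij => polyMap₂ 0 (h i j k hij)) where
  map_d i j i' j' hij h' hi hj a := by
    subst hi hj
    exact polyDeriv_mapRange (N.d i j hij) a
  skew i j k hij hji := polyMap₂_skew 0 _ _ _ (hN.skew i j k hij hji)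
  map_br i j k i' j' k' m i₁ j₁ hij hi hj hk hm h₁ h₂ h₃ hi₁ hj₁ h₄ h₅ a b := by
    subst hk hi₁ hj₁
    exact (polyDeriv_polyMap₂_one (N.br i j k hij) a b).trans (congrArg _
      (polyMap₂_boundary 0 _ _ _ _ _ _ _ _ (hN.bracket i j k i' j' m hij hi hj hm h₁ h₂ h₃) a b))
  jacobi i j k ij jk ik ij' jk' ik' s hij hjk hik hij' hjk' hik' h₁ h₂ h₃ h₁' h₂' h₃' a b c := by
    change polyMap₂ 0 (h i jk s h₁) a (polyMap₂ 1 (N.br j k jk hjk) b c)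
        + i.negOnePow • polyMap₂ 1 (N.br i jk' s h₁') a (polyMap₂ 0 (h j k jk' hjk') b c) =
      polyMap₂ 0 (h ij k s h₂) (polyMap₂ 1 (N.br i j ij hij) a b) c
        + polyMap₂ 1 (N.br ij' k s h₂') (polyMap₂ 0 (h i j ij' hij') a b) c
        + (i * j).negOnePow • (polyMap₂ 0 (h j ik s h₃) b (polyMap₂ 1 (N.br i k ik hik) a c)
          + j.negOnePow • polyMap₂ 1 (N.br j ik' s h₃') b (polyMap₂ 0 (h i k ik' hik') a c))
    change ℕ →₀ N.V i at a
    change ℕ →₀ N.V j at b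
    change ℕ →₀ N.V k at c
    induction a using Finsupp.induction_linear with
    | zero => simp
    | add f f' hf hf' =>
      simp only [map_add, LinearMap.add_apply, smul_add] at hf hf' ⊢
      rw [add_add_add_comm, hf, hf']
      abel
    | single l a =>
    induction b using Finsupp.induction_linear with
    | zero => simp
    | add f f' hf hf' =>
      simp only [map_add, LinearMap.add_apply, smul_add] at hf hf' ⊢
      rw [add_add_add_comm, hf, hf']
      abel
    | single m b =>
    induction c using Finsupp.induction_linear with
    | zero => simp
    | add f f' hf hf' =>
      simp only [map_add, smul_add] at hf hf' ⊢
      rw [add_add_add_comm, hf, hf']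
      abel
    | single n c =>
      have e₁ : l + (m + n + 1) + 0 = l + m + n + 1 := by omega
      have e₂ : l + (m + n + 0) + 1 = l + m + n + 1 := by omega
      have e₃ : l + m + 1 + n + 0 = l + m + n + 1 := by omega
      have e₄ : l + m + 0 + n + 1 = l + m + n + 1 := by omega
      have e₅ : m + (l + n + 1) + 0 = l + m + n + 1 := by omega
      have e₆ : m + (l + n + 0) + 1 = l + m + n + 1 := by omega
      simp only [polyMap₂_single, Finsupp.smul_single, ← Finsupp.single_add, e₁, e₂, e₃, e₄, e₅,
        e₆]
      rw [hN.jacobi i j k ij jk ik ij' jk' ik' s hij hjk hik hij' hjk' hik' h₁ h₂ h₃ h₁' h₂' h₃']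

/-! ### The two ends of the path -/

/-- A criterion on elements for quasi-isomorphisms: cocycles lift to cocycles, and a cocycle whose
image is a coboundary is a coboundary. -/
theorem Hom.isQuasiIso_of_lift {K : Type u} [Field K] {L : DGLA.{u, v} K} {M : DGLA.{u, w} K}
    (φ : Hom L M)
    (surj : ∀ (i : ℤ) (b : M.V i), M.d i (i + 1) rfl b = 0 →
      ∃ a : L.V i, L.d i (i + 1) rfl a = 0 ∧ φ.f i a = b)
    (inj : ∀ (i : ℤ) (a : L.V i) (b : M.V (i - 1)), L.d i (i + 1) rfl a = 0 →
      φ.f i a = M.d (i - 1) i (by omega) b → ∃ c, L.d (i - 1) i (by omega) c = a) :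
    φ.IsQuasiIso := by
  intro i
  constructor
  · rw [injective_iff_map_eq_zero]
    intro x hx
    obtain ⟨⟨a, ha⟩, rfl⟩ := Submodule.mkQ_surjective _ x
    rw [Submodule.mkQ_apply, Hom.cohomologyMap, Submodule.mapQ_apply,
      Submodule.Quotient.mk_eq_zero] at hx
    obtain ⟨b, hb⟩ := hx
    rw [Submodule.mkQ_apply, Submodule.Quotient.mk_eq_zero]
    exact inj i a b ha hb.symm
  · intro y
    obtain ⟨⟨b, hb⟩, rfl⟩ := Submodule.mkQ_surjective _ y
    obtain ⟨a, ha, rfl⟩ := surj i b hb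
    exact ⟨Submodule.mkQ _ ⟨a, ha⟩, rfl⟩

/-- The DGLA with the underlying complex of `N` and the zero bracket. -/
def abelianization {K : Type u} [Field K] (N : DGLA.{u, v} K) : DGLA.{u, v} K where
  V := N.V
  d := N.d
  br _ _ _ _ := 0
  d_d := N.d_d
  skew _ _ _ _ _ _ _ := by simp
  jacobi _ _ _ _ _ _ _ _ _ _ _ _ _ _ _ _ := by simp
  leibniz _ _ _ _ _ _ _ _ _ _ _ _ _ _ := by simp

section

variable {K : Type u} [Field K] {N : DGLA.{u, v} K} {h : N.BilinNegOne}
  (hN : N.IsBracketPrimitive h)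

/-- The DGLA `N[s] ⊕ ds N[s]` with the differential `d + ds ∂ₛ` and the bracket
`s [·,·] + ds h`. -/
def IsBracketPrimitive.path : DGLA.{u, v} K :=
  N.scaledPoly.twistedPath _ _ hN.isTwist

/-- The evaluation at `s = 1`. -/
def IsBracketPrimitive.evalOne : Hom hN.path N where
  f i := polyEval (N.V i) (1 : K) ∘ₗ LinearMap.fst K (ℕ →₀ N.V i) (ℕ →₀ N.V (i - 1))
  map_d i j hij a := polyEval_mapRange 1 (N.d i j hij) a.1
  map_br i j k hij a b := by
    refine (polyEval_polyMap₂ 1 1 (N.br i j k hij) a.1 b.1).trans ?_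
    rw [one_pow, one_smul]
    rfl

/-- The evaluation at `s = 0`. -/
def IsBracketPrimitive.evalZero : Hom hN.path N.abelianization where
  f i := polyEval (N.V i) (0 : K) ∘ₗ LinearMap.fst K (ℕ →₀ N.V i) (ℕ →₀ N.V (i - 1))
  map_d i j hij a := polyEval_mapRange 0 (N.d i j hij) a.1
  map_br i j k hij a b := by
    refine (polyEval_polyMap₂ 0 1 (N.br i j k hij) a.1 b.1).trans ?_
    rw [pow_one, zero_smul]
    rfl

/-- A constant polynomial is a cocycle of the path if its value is a cocycle. -/
theorem IsBracketPrimitive.exists_cocycle_eval (c : K) (i : ℤ) (b : N.V i)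
    (hb : N.d i (i + 1) rfl b = 0) :
    ∃ a : hN.path.V i, hN.path.d i (i + 1) rfl a = 0 ∧ polyEval (N.V i) c a.1 = b := by
  refine ⟨(Finsupp.single 0 b, 0), Prod.ext ?_ ?_, by simp⟩
  · change Finsupp.mapRange.linearMap (N.d i (i + 1) rfl) (Finsupp.single 0 b) = 0
    simp [hb]
  · have e (j : ℤ) (hj : i = j) : (hj ▸ polyDeriv K (N.V i) : (ℕ →₀ N.V i) →ₗ[K] (ℕ →₀ N.V j))
        (Finsupp.single 0 b) = 0 := by
      subst hj
      simp
    exact (congrArg₂ (· - ·) (e _ _) (map_zero (Finsupp.mapRange.linearMap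
      (N.d (i - 1) (i + 1 - 1) (by omega))))).trans (sub_zero (0 : ℕ →₀ N.V (i + 1 - 1)))

/-- If the value of the cocycle `x + ds y` at `s = c` is the coboundary of `u`, then the cocycle
is the coboundary of `u + ∫_c^s y`. -/
theorem IsBracketPrimitive.exists_boundary_eval [CharZero K] (c : K) (i : ℤ) (a : hN.path.V i)
    (b : N.V (i - 1)) (ha : hN.path.d i (i + 1) rfl a = 0)
    (hab : polyEval (N.V i) c a.1 = N.d (i - 1) i (by omega) b) :
    ∃ z, hN.path.d (i - 1) i (by omega) z = a := by
  have key (j : ℤ) (hj : i = j) (hj' : i - 1 + 1 = j) (x : ℕ →₀ N.V i) (y : ℕ →₀ N.V (i - 1))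
      (hxy : (hj ▸ polyDeriv K (N.V i) : (ℕ →₀ N.V i) →ₗ[K] (ℕ →₀ N.V j)) x
        = Finsupp.mapRange.linearMap (N.d (i - 1) j hj') y)
      (hx : polyEval (N.V i) c x = N.d (i - 1) i (by omega) b) :
      Finsupp.mapRange.linearMap (N.d (i - 1) i (by omega))
        (polyInt (N.V (i - 1)) c y + Finsupp.single 0 b) = x := by
    subst hj
    have hxy' : polyDeriv K (N.V i) x = Finsupp.mapRange.linearMap (N.d (i - 1) i hj') y := hxy
    rw [map_add, ← polyInt_mapRange, ← hxy', polyInt_polyDeriv, hx]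
    simp
  refine ⟨(polyInt (N.V (i - 1)) c a.2 + Finsupp.single 0 b, 0), Prod.ext ?_ ?_⟩
  · exact key (i + 1 - 1) (by omega) (by omega) a.1 a.2 (sub_eq_zero.1 (congrArg Prod.snd ha)) hab
  · have e (y : ℕ →₀ N.V (i - 1)) :
        polyDeriv K (N.V (i - 1)) (polyInt (N.V (i - 1)) c y + Finsupp.single 0 b) = y := by
      rw [map_add, polyDeriv_polyInt]
      simp
    exact (congrArg₂ (· - ·) (e a.2) (map_zero (Finsupp.mapRange.linearMap
      (N.d (i - 1 - 1) (i - 1) (by omega))))).trans (sub_zero (a.2 : ℕ →₀ N.V (i - 1)))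

theorem IsBracketPrimitive.isHomotopyAbelian [CharZero K] (hN : N.IsBracketPrimitive h) :
    N.IsHomotopyAbelian :=
  ⟨hN.path, N.abelianization, hN.evalOne, hN.evalZero,
    hN.evalOne.isQuasiIso_of_lift (hN.exists_cocycle_eval 1) (hN.exists_boundary_eval 1),
    hN.evalZero.isQuasiIso_of_lift (hN.exists_cocycle_eval 0) (hN.exists_boundary_eval 0),
    fun _ _ _ _ _ _ => rfl⟩

end

end DGLA

/-! ### Primitives on tensor products -/

namespace CDGATensor

variable {K : Type u} [Field K] (P : CDGA.{u, w} K) {L : DGLA.{u, v} K}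

/-- The extension of a bilinear map `h` of degree `-1` to `P ⊗ L`,
`(ω ⊗ a, η ⊗ b) ↦ (-1)^{|ω| + |η| + |a||η|} ωη ⊗ h(a,b)`. The sign is that of moving `ω` past `h`
and `η` past `h` and `a`. -/
def primitive (h : L.BilinNegOne) (p q r : ℤ) (hr : p + q - 1 = r) :
    V P L p →ₗ[K] V P L q →ₗ[K] V P L r :=
  DirectSum.toModule K _ _ fun x => LinearMap.flip <| DirectSum.toModule K _ _ fun y =>
    LinearMap.flip <|
      (TensorProduct.map₂ (P.mul x.1.1 y.1.1 (x.1.1 + y.1.1) rfl)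
        (h x.1.2 y.1.2 (x.1.2 + y.1.2 - 1) rfl)).compr₂
      ((x.1.1 + y.1.1 + x.1.2 * y.1.1).negOnePow • incl P L (x.1.1 + y.1.1)
        (x.1.2 + y.1.2 - 1) r (by have := x.2; have := y.2; omega))

variable {P}

theorem primitive_incl (h : L.BilinNegOne) (p q r : ℤ) (hr : p + q - 1 = r)
    (i j i' j' i'' j'' : ℤ) (hij : i + j = p) (hij' : i' + j' = q) (hi : i + i' = i'')
    (hj : j + j' - 1 = j'') (h'' : i'' + j'' = r)
    (ω : P.V i) (a : L.V j) (η : P.V i') (b : L.V j') :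
    primitive P h p q r hr (incl P L i j p hij (ω ⊗ₜ a)) (incl P L i' j' q hij' (η ⊗ₜ b)) =
      (i + i' + j * i').negOnePow • incl P L i'' j'' r h''
        (P.mul i i' i'' hi ω η ⊗ₜ h j j' j'' hj a b) := by
  subst hi hj
  simp only [primitive]
  rw [toModule_incl, LinearMap.flip_apply, toModule_incl]
  simp [Units.smul_def]

theorem primitive_skew {h : L.BilinNegOne} (hL : L.IsBracketPrimitive h) (p q r : ℤ)
    (hr : p + q - 1 = r) (hr' : q + p - 1 = r) (x : V P L p) (y : V P L q) :
    primitive P h p q r hr x y = -((p * q).negOnePow • primitive P h q p r hr' y x) := by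
  induction x using induction with
  | zero => simp
  | add x x' hx hx' => simp only [map_add, LinearMap.add_apply, hx, hx', smul_add, neg_add]
  | pure i j hij ω a =>
    induction y using induction with
    | zero => simp
    | add y y' hy hy' => simp only [map_add, LinearMap.add_apply, hy, hy', smul_add, neg_add]
    | pure k l hkl η b =>
      rw [primitive_incl h p q r hr i j k l (i + k) (j + l - 1) _ _ rfl rfl (by omega),
        primitive_incl h q p r hr' k l i j (i + k) (j + l - 1) _ _ (by omega) (by omega)
          (by omega),
        P.mul_comm i k _ rfl (by omega), hL.skew j l _ rfl (by omega),
        sign_tmul, TensorProduct.tmul_neg, tmul_sign, smul_neg, map_neg, smul_neg]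
      simp only [map_sign, smul_smul, ← Int.negOnePow_add]
      congr 2
      rw [Int.negOnePow_eq_iff]
      subst hij hkl
      exact ⟨-(i * l), by ring⟩

theorem primitive_bracket {h : L.BilinNegOne} (hL : L.IsBracketPrimitive h)
    (p q r p' q' m : ℤ) (hr : p + q = r) (hp : p + 1 = p') (hq : q + 1 = q') (hm : m + 1 = r)
    (h₁ : p + q - 1 = m) (h₂ : p' + q - 1 = r) (h₃ : p + q' - 1 = r)
    (x : V P L p) (y : V P L q) :
    br P L p q r hr x y = d P L m r hm (primitive P h p q m h₁ x y)
      + primitive P h p' q r h₂ (d P L p p' hp x) y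
      + p.negOnePow • primitive P h p q' r h₃ x (d P L q q' hq y) := by
  induction x using induction with
  | zero => simp
  | add x x' hx hx' => simp only [map_add, LinearMap.add_apply, hx, hx', smul_add]; abel
  | pure i j hij ω a =>
    induction y using induction with
    | zero => simp
    | add y y' hy hy' => simp only [map_add, hy, hy', smul_add]; abel
    | pure k l hkl η b =>
      rw [br_incl p q r hr i j k l (i + k) (j + l) _ _ rfl rfl (by omega),
        primitive_incl h p q m h₁ i j k l (i + k) (j + l - 1) _ _ rfl rfl (by omega), map_sign,
        d_incl m r hm (i + k) (j + l - 1) _ (i + k + 1) (j + l) rfl (by omega) (by omega)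
          (by omega),
        d_incl p p' hp i j _ (i + 1) (j + 1) rfl rfl (by omega) (by omega),
        d_incl q q' hq k l _ (k + 1) (l + 1) rfl rfl (by omega) (by omega),
        P.leibniz i k _ (i + 1) (k + 1) (i + k + 1) rfl rfl rfl rfl (by omega) (by omega),
        hL.bracket j l _ (j + 1) (l + 1) (j + l - 1) rfl rfl rfl (by omega) (by omega) (by omega)
          (by omega)]
      simp only [map_add, map_sign, map_sign₂, LinearMap.add_apply]
      rw [primitive_incl h p' q r h₂ (i + 1) j k l (i + k + 1) (j + l - 1) _ _ (by omega)
          (by omega) (by omega),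
        primitive_incl h p' q r h₂ i (j + 1) k l (i + k) (j + l) _ _ (by omega) (by omega)
          (by omega),
        primitive_incl h p q' r h₃ i j (k + 1) l (i + k + 1) (j + l - 1) _ _ (by omega) (by omega)
          (by omega),
        primitive_incl h p q' r h₃ i j k (l + 1) (i + k) (j + l) _ _ (by omega) (by omega)
          (by omega)]
      simp only [TensorProduct.add_tmul, TensorProduct.tmul_add, sign_tmul, tmul_sign, map_add,
        map_sign, smul_add, smul_smul, ← Int.negOnePow_add]
      have e₁ : (i + 1 + k + j * k).negOnePow = -(i + k + j * k).negOnePow := by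
        rw [← Int.negOnePow_succ]; congr 1; ring
      have e₂ : (p + (i + (k + 1) + j * (k + 1))).negOnePow =
          -(i + k + j * k + i).negOnePow := by
        rw [← Int.negOnePow_succ, Int.negOnePow_eq_iff, ← hij]; exact ⟨j, by ring⟩
      have e₄ : (i + k + j * k + (i + k)).negOnePow = (j * k).negOnePow := by
        rw [Int.negOnePow_eq_iff]; exact ⟨i + k, by ring⟩
      have e₅ : (i + (i + k + (j + 1) * k)).negOnePow = (j * k).negOnePow := by
        rw [Int.negOnePow_eq_iff]; exact ⟨i + k, by ring⟩
      have e₆ : (p + (k + (i + k + j * k))).negOnePow = (j * k + j).negOnePow := by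
        rw [Int.negOnePow_eq_iff, ← hij]; exact ⟨i + k, by ring⟩
      simp only [e₁, e₂, e₄, e₅, e₆, Units.neg_smul]
      abel

theorem primitive_jacobi {h : L.BilinNegOne} (hL : L.IsBracketPrimitive h)
    (p q r pq qr pr pq' qr' pr' s : ℤ) (hpq : p + q = pq) (hqr : q + r = qr) (hpr : p + r = pr)
    (hpq' : p + q - 1 = pq') (hqr' : q + r - 1 = qr') (hpr' : p + r - 1 = pr')
    (h₁ : p + qr - 1 = s) (h₂ : pq + r - 1 = s) (h₃ : q + pr - 1 = s)
    (h₁' : p + qr' = s) (h₂' : pq' + r = s) (h₃' : q + pr' = s)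
    (x : V P L p) (y : V P L q) (z : V P L r) :
    primitive P h p qr s h₁ x (br P L q r qr hqr y z)
        + p.negOnePow • br P L p qr' s h₁' x (primitive P h q r qr' hqr' y z) =
      primitive P h pq r s h₂ (br P L p q pq hpq x y) z
        + br P L pq' r s h₂' (primitive P h p q pq' hpq' x y) z
        + (p * q).negOnePow • (primitive P h q pr s h₃ y (br P L p r pr hpr x z)
          + q.negOnePow • br P L q pr' s h₃' y (primitive P h p r pr' hpr' x z)) := by
  induction x using induction with
  | zero => simp
  | add x x' hx hx' =>
    simp only [map_add, LinearMap.add_apply, smul_add] at hx hx' ⊢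
    rw [add_add_add_comm, hx, hx']
    abel
  | pure i j hij ω a =>
  induction y using induction with
  | zero => simp
  | add y y' hy hy' =>
    simp only [map_add, LinearMap.add_apply, smul_add] at hy hy' ⊢
    rw [add_add_add_comm, hy, hy']
    abel
  | pure k l hkl η b =>
  induction z using induction with
  | zero => simp
  | add z z' hz hz' =>
    simp only [map_add, smul_add] at hz hz' ⊢
    rw [add_add_add_comm, hz, hz']
    abel
  | pure m n hmn ζ c =>
    rw [br_incl q r qr hqr k l m n (k + m) (l + n) _ _ rfl rfl (by omega),
      br_incl p q pq hpq i j k l (i + k) (j + l) _ _ rfl rfl (by omega),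
      br_incl p r pr hpr i j m n (i + m) (j + n) _ _ rfl rfl (by omega),
      primitive_incl h q r qr' hqr' k l m n (k + m) (l + n - 1) _ _ rfl rfl (by omega),
      primitive_incl h p q pq' hpq' i j k l (i + k) (j + l - 1) _ _ rfl rfl (by omega),
      primitive_incl h p r pr' hpr' i j m n (i + m) (j + n - 1) _ _ rfl rfl (by omega)]
    simp only [map_sign, map_sign₂]
    rw [primitive_incl h p qr s h₁ i j (k + m) (l + n) (i + k + m) (j + l + n - 1) _ _
        (by omega) (by omega) (by omega),
      primitive_incl h pq r s h₂ (i + k) (j + l) m n (i + k + m) (j + l + n - 1) _ _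
        (by omega) (by omega) (by omega),
      primitive_incl h q pr s h₃ k l (i + m) (j + n) (i + k + m) (j + l + n - 1) _ _
        (by omega) (by omega) (by omega),
      br_incl p qr' s h₁' i j (k + m) (l + n - 1) (i + k + m) (j + l + n - 1) _ _
        (by omega) (by omega) (by omega),
      br_incl pq' r s h₂' (i + k) (j + l - 1) m n (i + k + m) (j + l + n - 1) _ _
        (by omega) (by omega) (by omega),
      br_incl q pr' s h₃' k l (i + m) (j + n - 1) (i + k + m) (j + l + n - 1) _ _
        (by omega) (by omega) (by omega)]
    have e : P.mul k (i + m) (i + k + m) (by omega) η (P.mul i m (i + m) rfl ω ζ) =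
        (i * k).negOnePow •
          P.mul i (k + m) (i + k + m) (by omega) ω (P.mul k m (k + m) rfl η ζ) := by
      rw [← P.mul_assoc i k m (i + k) _ _ rfl rfl rfl, ← P.mul_assoc k i m (i + k) _ _ (by omega)
        rfl rfl, P.mul_comm i k _ rfl (by omega), map_sign₂, smul_smul,
        Int.units_mul_self, one_smul]
    -- The Jacobi-shaped identity of `h` on the coefficients, with the common factor
    -- `± ω η ζ ⊗ _` put in front; it remains to compare signs.
    have key := congrArg (fun u => (i + k + m + j * k + j * m + l * m).negOnePow •
      incl P L (i + k + m) (j + l + n - 1) s (by omega)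
        (P.mul i (k + m) (i + k + m) (by omega) ω (P.mul k m (k + m) rfl η ζ) ⊗ₜ u))
      (hL.jacobi j l n (j + l) (l + n) (j + n) (j + l - 1) (l + n - 1) (j + n - 1) (j + l + n - 1)
        rfl rfl rfl rfl rfl rfl (by omega) (by omega) (by omega) (by omega) (by omega) (by omega)
        a b c)
    rw [P.mul_assoc i k m (i + k) (k + m) _ rfl rfl rfl (by omega), e]
    simp only [sign_tmul, TensorProduct.tmul_add, tmul_sign, map_add, map_sign, smul_add, smul_smul,
      ← Int.negOnePow_add] at key ⊢
    have s₁ : (l * m + (i + (k + m) + j * (k + m))).negOnePow =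
        (i + k + m + j * k + j * m + l * m).negOnePow := by
      congr 1; ring
    have s₂ : (p + (k + m + l * m + j * (k + m))).negOnePow =
        (i + k + m + j * k + j * m + l * m + j).negOnePow := by
      rw [← hij]; congr 1; ring
    have s₃ : (j * k + (i + k + m + (j + l) * m)).negOnePow =
        (i + k + m + j * k + j * m + l * m).negOnePow := by
      congr 1; ring
    have s₄ : (i + k + j * k + (j + l - 1) * m).negOnePow =
        (i + k + m + j * k + j * m + l * m).negOnePow := by
      rw [Int.negOnePow_eq_iff]; exact ⟨-m, by ring⟩
    have s₅ : (p * q + (j * m + (k + (i + m) + l * (i + m) + i * k))).negOnePow =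
        (i + k + m + j * k + j * m + l * m + j * l).negOnePow := by
      rw [Int.negOnePow_eq_iff, ← hij, ← hkl]; exact ⟨i * l + i * k, by ring⟩
    have s₆ : (p * q + (q + (i + m + j * m + (l * (i + m) + i * k)))).negOnePow =
        (i + k + m + j * k + j * m + l * m + (j * l + l)).negOnePow := by
      rw [Int.negOnePow_eq_iff, ← hij, ← hkl]; exact ⟨i * l + i * k, by ring⟩
    rw [s₁, s₂, s₃, s₄, s₅, s₆]
    exact key

theorem map_primitive {Q : CDGA.{u, w} K} {M : DGLA.{u, v} K} (f : CDGA.Hom P Q)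
    (g : DGLA.Hom L M) {h : L.BilinNegOne} {h' : M.BilinNegOne}
    (hg : ∀ (i j k : ℤ) (hk : i + j - 1 = k) (a : L.V i) (b : L.V j),
      h' i j k hk (g.f i a) (g.f j b) = g.f k (h i j k hk a b))
    (p q r : ℤ) (hr : p + q - 1 = r) (x : V P L p) (y : V P L q) :
    map f g r (primitive P h p q r hr x y) =
      primitive Q h' p q r hr (map f g p x) (map f g q y) := by
  induction x using induction with
  | zero => simp
  | add x x' hx hx' => simp only [map_add, LinearMap.add_apply, hx, hx']
  | pure i j hij ω a =>
    induction y using induction with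
    | zero => simp
    | add y y' hy hy' => simp only [map_add, hy, hy']
    | pure k l hkl η b =>
      rw [primitive_incl h p q r hr i j k l (i + k) (j + l - 1) _ _ rfl rfl (by omega), map_sign,
        map_incl, map_incl, map_incl,
        primitive_incl h' p q r hr i j k l (i + k) (j + l - 1) _ _ rfl rfl (by omega), f.map_mul,
        hg]

end CDGATensor

theorem DGLA.IsBracketPrimitive.tensor {K : Type u} [Field K] (P : CDGA.{u, w} K)
    {L : DGLA.{u, v} K} {h : L.BilinNegOne} (hL : L.IsBracketPrimitive h) :
    (DGLA.tensor P L).IsBracketPrimitive (CDGATensor.primitive P h) where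
  skew := CDGATensor.primitive_skew hL
  bracket := CDGATensor.primitive_bracket hL
  jacobi := CDGATensor.primitive_jacobi hL

/-! ### Primitives on totalizations -/

namespace SemicosimplicialDGLA

variable {K : Type u} [Field K] (L : SemicosimplicialDGLA.{u, v} K)

/-- The bilinear map of degree `-1` on the totalization that is induced componentwise by bilinear
maps `hₙ` on the DGLAs `Lₙ` compatible with the face operators. -/
def totPrimitive (h : ∀ n : ℕ, (L.obj n).BilinNegOne)
    (h_face : ∀ (n : ℕ) (m : Fin (n + 2)) (i j k : ℤ) (hk : i + j - 1 = k)
      (a : (L.obj n).V i) (b : (L.obj n).V j),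
      h (n + 1) i j k hk ((L.face n m).f i a) ((L.face n m).f j b) =
        (L.face n m).f k (h n i j k hk a b)) : L.Tot.BilinNegOne := fun p q r hr =>
  LinearMap.mk₂ K
    (fun (x : L.totV p) (y : L.totV q) => (⟨fun n =>
        CDGATensor.primitive (Omega K n) (h n) p q r hr (x.1 n) (y.1 n), fun n k => by
      have e₁ := CDGATensor.map_primitive (Omega.face k) (DGLA.Hom.id (L.obj (n + 1)))
        (h := h (n + 1)) (h' := h (n + 1)) (fun _ _ _ _ _ _ => rfl) p q r hr (x.1 (n + 1))
        (y.1 (n + 1))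
      have e₂ := CDGATensor.map_primitive (CDGA.Hom.id (Omega K n)) (L.face n k) (h_face n k)
        p q r hr (x.1 n) (y.1 n)
      refine e₁.trans (Eq.trans ?_ e₂.symm)
      exact congrArg₂ (fun u v => CDGATensor.primitive (Omega K n) (h (n + 1)) p q r hr u v)
        (x.2 n k) (y.2 n k)⟩ : L.totV r))
    (fun x x' y => Subtype.ext <| funext fun n =>
      LinearMap.map_add₂ (CDGATensor.primitive (Omega K n) (h n) p q r hr) (x.1 n) (x'.1 n) (y.1 n))
    (fun c x y => Subtype.ext <| funext fun n =>
      LinearMap.map_smul₂ (CDGATensor.primitive (Omega K n) (h n) p q r hr) c (x.1 n) (y.1 n))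
    (fun x y y' => Subtype.ext <| funext fun n =>
      map_add (CDGATensor.primitive (Omega K n) (h n) p q r hr (x.1 n)) (y.1 n) (y'.1 n))
    (fun c x y => Subtype.ext <| funext fun n =>
      map_smul (CDGATensor.primitive (Omega K n) (h n) p q r hr (x.1 n)) c (y.1 n))

theorem isBracketPrimitive_totPrimitive {h : ∀ n : ℕ, (L.obj n).BilinNegOne}
    (hL : ∀ n, (L.obj n).IsBracketPrimitive (h n))
    (h_face : ∀ (n : ℕ) (m : Fin (n + 2)) (i j k : ℤ) (hk : i + j - 1 = k)
      (a : (L.obj n).V i) (b : (L.obj n).V j),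
      h (n + 1) i j k hk ((L.face n m).f i a) ((L.face n m).f j b) =
        (L.face n m).f k (h n i j k hk a b)) :
    L.Tot.IsBracketPrimitive (L.totPrimitive h h_face) where
  skew p q r hr hr' x y := Subtype.ext <| funext fun n =>
    ((hL n).tensor (Omega K n)).skew p q r hr hr' (x.1 n) (y.1 n)
  bracket p q r p' q' m hr hp hq hm h₁ h₂ h₃ x y := Subtype.ext <| funext fun n =>
    ((hL n).tensor (Omega K n)).bracket p q r p' q' m hr hp hq hm h₁ h₂ h₃ (x.1 n) (y.1 n)
  jacobi p q r pq qr pr pq' qr' pr' s hpq hqr hpr hpq' hqr' hpr' h₁ h₂ h₃ h₁' h₂' h₃' x y z :=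
    Subtype.ext <| funext fun n =>
      ((hL n).tensor (Omega K n)).jacobi p q r pq qr pr pq' qr' pr' s hpq hqr hpr hpq' hqr' hpr'
        h₁ h₂ h₃ h₁' h₂' h₃' (x.1 n) (y.1 n) (z.1 n)

end SemicosimplicialDGLA

end

theorem corollary6p2 {K : Type u} [Field K] [CharZero K] (L : SemicosimplicialDGLA.{u, v} K)
    (h : ∀ n : ℕ, (L.obj n).BilinNegOne)
    (h_criterion : ∀ n : ℕ, (L.obj n).IsAbelianityHomotopy (h n))
    (h_face : ∀ (n : ℕ) (m : Fin (n + 2)) (i j k : ℤ) (hk : i + j - 1 = k)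
      (a : (L.obj n).V i) (b : (L.obj n).V j),
      h (n + 1) i j k hk ((L.face n m).f i a) ((L.face n m).f j b) =
        (L.face n m).f k (h n i j k hk a b)) :
    L.Tot.IsHomotopyAbelian :=
  (L.isBracketPrimitive_totPrimitive (fun n => (h_criterion n).isBracketPrimitive)
    h_face).isHomotopyAbelian
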